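/- **Conventions.** All algebras are unital and over $\mathbb{C}$. A *finite quantum group* $\Gamma$ is a finite-dimensional Hopf $*$-algebra $C(\Gamma)$ (multiplication $m$, unit $\eta$, comultiplication $\Delta$ and counit $\epsilon$ which are $*$-homomorphisms, antipode $S$) whose underlying $*$-algebra is a C\*-algebra. Its Haar functional $\psi$ is the positive functional with $(\psi\otimes\mathrm{id})\Delta(f)=\psi(f)1$, normalized so that, for the inner product $\langle a,b\rangle=\psi(a^*b)$, the algebra $C(\Gamma)$ is a special symmetric Frobenius $*$-algebra: $(a,b)\mapsto\psi(ab)$ is non-degenerate and symmetric, and $mm^\dagger=\mathrm{id}$. Here and below $\dagger$ is the adjoint for this inner product (and for the induced one on tensor products), so that $\psi=\eta^\dagger$. Write $l^2(\Gamma)$ for the resulting Hilbert space, $n=\dim C(\Gamma)$, and for $x,y\in l^2(\Gamma)$ put $x\bullet y=m(x\otimes y)$, $x*y=\Delta^\dagger(x\otimes y)$, $x^\star=S(x^*)$, and $A_xy=x*y$. For operators on $l^2(\Gamma)$ let $A\bullet B=m(A\otimes B)m^\dagger$ (Schur product), $A^*(f)=(A(f^*))^*$ and $J=\eta\eta^\dagger$.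 A *quantum coherent algebra* is a linear space of operators on $l^2(\Gamma)$ that is closed under composition, Schur product, $\dagger$ and $*$ and contains $I$ and $J$. A *quantum Schur ring* is a subspace $S\subset l^2(\Gamma)$ that is closed under $\bullet,*,{}^*,{}^\star$ and contains the units $\eta$ and $\epsilon^\dagger$. A *quantum translation association scheme* $\mathbf{A}$ over $\Gamma$ is given by a quantum coherent algebra $\operatorname{span}\mathbf{A}\subset\{A_x\mid x\in l^2(\Gamma)\}$; the one corresponding to a quantum Schur ring $S$ has $\operatorname{span}\mathbf{A}=\{A_x\mid x\in S\}$. The *dual* $\hat\Gamma$ is the finite quantum group with a linear isomorphism $x\mapsto\hat x$, $C(\Gamma)\to C(\hat\Gamma)$ (the *Fourier transform*) that carries the multiplication $\Delta^\dagger$, unit $\epsilon^\dagger$, comultiplication $m^\dagger$, counit $\psi$, antipode $S$ and involution ${}^\star$ to the Hopf $*$-algebra structure of $C(\hat\Gamma)$. On $\hat\Gamma$ the operations $*$, $\dagger$, $A_{\hat x}$ are formed with the normalized Haar functional of $\hat\Gamma$. **Theorem.** Let $\Gamma$ be a finite quantum group. Its normalized Haar functional exists and is unique, and the dual finite quantum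 group $\hat\Gamma$ exists. Let $S\subset l^2(\Gamma)$ be a quantum Schur ring and $\mathbf{A}$ the corresponding quantum translation association scheme, $\operatorname{span}\mathbf{A}=\{A_x\mid x\in S\}$. Then $\hat S=\{\hat x\mid x\in S\}$ is a quantum Schur ring in $l^2(\hat\Gamma)$, so that $$\operatorname{span}\hat{\mathbf{A}}=\{A_{\hat x}\mid x\in S\}$$ defines a quantum translation association scheme $\hat{\mathbf{A}}$ over $\hat\Gamma$, and $\hat{\mathbf{A}}$ is dual to $\mathbf{A}$: one has $\dim C(\hat\Gamma)=\dim C(\Gamma)=n$, and there is a vector space isomorphism $\Phi\colon\operatorname{span}\mathbf{A}\to\operatorname{span}\hat{\mathbf{A}}$, namely $\Phi(A_x)=\tfrac1n A_{\hat x}$ for $x\in S$, such that for all $X,Y\in\operatorname{span}\mathbf{A}$ $$\Phi(XY)=n\,\Phi(X)\bullet\Phi(Y),\qquad \Phi(X\bullet Y)=\Phi(X)\,\Phi(Y),\qquad \Phi(X^\dagger)=\Phi(X)^*,\qquad \Phi(X^*)=\Phi(X)^\dagger .$$ -/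

import Mathlib

open scoped TensorProduct ComplexOrder

universe u v

section FrobeniusAlgebras

variable {A : Type u} [Ring A] [StarRing A] [Algebra ℂ A]

/-- `ψ` makes the `*`-algebra `A` into a Frobenius `*`-algebra: `ψ` is positive and the bilinear
form `(a, b) ↦ ψ (a * b)` is non-degenerate. -/
structure IsFrobenius (ψ : A →ₗ[ℂ] ℂ) : Prop where
  positive : ∀ a : A, 0 ≤ ψ (star a * a)
  nondegenerate : ((LinearMap.mul ℂ A).compr₂ ψ).Nondegenerate

namespace IsFrobenius

variable [StarModule ℂ A] {ψ : A →ₗ[ℂ] ℂ}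

theorem conj_apply (h : IsFrobenius ψ) (a : A) : star (ψ a) = ψ (star a) := by
  have h0 := h.positive a
  have h1 := h.positive 1
  have h2 := h.positive (1 + a)
  have h3 := h.positive (1 + Complex.I • a)
  simp only [star_add, star_one, star_smul, mul_add, add_mul, one_mul, mul_one, map_add,
    smul_mul_assoc, mul_smul_comm, map_smul, smul_eq_mul, Complex.le_def, Complex.add_im,
    Complex.mul_im, Complex.mul_re, Complex.zero_im, Complex.star_def, Complex.conj_I,
    Complex.neg_re, Complex.neg_im, Complex.I_re, Complex.I_im] at h0 h1 h2 h3
  apply Complex.ext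
  · simp only [Complex.star_def, Complex.conj_re]
    linarith [h0.2, h1.2, h2.2, h3.2]
  · simp only [Complex.star_def, Complex.conj_im]
    linarith [h0.2, h1.2, h2.2, h3.2]

/-- The form `⟨a, b⟩ = ψ (a^* b)`, before definiteness is known. -/
@[reducible]
def preCore (h : IsFrobenius ψ) : PreInnerProductSpace.Core ℂ A where
  inner a b := ψ (star a * b)
  conj_inner_symm a b := by
    have := h.conj_apply (star b * a)
    simpa using this
  re_inner_nonneg a := (Complex.le_def.1 (h.positive a)).1
  add_left a b c := by simp [add_mul]
  smul_left a b r := by simp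

/-- The inner product `⟨a, b⟩ = ψ (a^* b)`. -/
@[reducible]
def core (h : IsFrobenius ψ) : InnerProductSpace.Core ℂ A where
  __ := h.preCore
  definite a ha := by
    apply h.nondegenerate.2 a
    intro b
    have h1 := @InnerProductSpace.Core.inner_mul_inner_self_le ℂ A _ _ _ h.preCore (star b) a
    have h2 : ψ (star a * a) = 0 := ha
    have h3 : ψ (star a * star b) = star (ψ (b * a)) := by
      rw [h.conj_apply, star_mul]
    change ‖ψ (star (star b) * a)‖ * ‖ψ (star a * star b)‖ ≤
      RCLike.re (ψ (star (star b) * star b)) * RCLike.re (ψ (star a * a)) at h1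
    rw [h2, h3, star_star, norm_star] at h1
    have h4 : ‖ψ (b * a)‖ = 0 := by
      have := norm_nonneg (ψ (b * a))
      simp only [map_zero, mul_zero] at h1
      nlinarith
    simpa using h4

/-- The norm of the Hilbert space `l²` of a Frobenius `*`-algebra. -/
@[reducible]
noncomputable def normedAddCommGroup (h : IsFrobenius ψ) : NormedAddCommGroup A :=
  h.core.toNormedAddCommGroup

/-- The Hilbert space `l²` of a Frobenius `*`-algebra. -/
@[reducible]
noncomputable def innerProductSpace (h : IsFrobenius ψ) :
    @InnerProductSpace ℂ A _ h.normedAddCommGroup.toSeminormedAddCommGroup :=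
  letI := h.normedAddCommGroup
  InnerProductSpace.ofCore h.core.toCore

/-- The inner product of the Hilbert space `l² ⊗ l²`, for which
`⟨a ⊗ b, c ⊗ d⟩ = ⟨a, c⟩ * ⟨b, d⟩`. -/
@[reducible]
noncomputable def normedAddCommGroupTensor (h : IsFrobenius ψ) : NormedAddCommGroup (A ⊗[ℂ] A) :=
  @TensorProduct.instNormedAddCommGroup ℂ A A _ h.normedAddCommGroup h.innerProductSpace
    h.normedAddCommGroup h.innerProductSpace

/-- The Hilbert space `l² ⊗ l²`. -/
@[reducible]
noncomputable def innerProductSpaceTensor (h : IsFrobenius ψ) :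
    @InnerProductSpace ℂ (A ⊗[ℂ] A) _ h.normedAddCommGroupTensor.toSeminormedAddCommGroup :=
  @TensorProduct.instInnerProductSpace ℂ A A _ h.normedAddCommGroup h.innerProductSpace
    h.normedAddCommGroup h.innerProductSpace

theorem inner_tensor (h : IsFrobenius ψ) (s t : A ⊗[ℂ] A) :
    h.innerProductSpaceTensor.inner s t =
      LinearMap.mul' ℂ ℂ (TensorProduct.map ψ ψ (star s * t)) := by
  let _ := h.normedAddCommGroup
  let _ := h.innerProductSpace
  let _ := h.normedAddCommGroupTensor
  let _ := h.innerProductSpaceTensor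
  change inner ℂ s t = _
  induction s using TensorProduct.induction_on with
  | zero => rw [inner_zero_left]; simp
  | add a b ha hb => rw [inner_add_left, ha, hb]; simp [add_mul]
  | tmul a b =>
    induction t using TensorProduct.induction_on with
    | zero => rw [inner_zero_right]; simp
    | add c d hc hd => rw [inner_add_right, hc, hd]; simp [mul_add]
    | tmul c d =>
      simp only [TensorProduct.star_tmul, Algebra.TensorProduct.tmul_mul_tmul,
        TensorProduct.map_tmul, LinearMap.mul'_apply]
      rfl

variable [FiniteDimensional ℂ A]

/-- The adjoint `T† : l² → l²` of a linear map `T : l² → l²`. -/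
noncomputable def dagger (h : IsFrobenius ψ) (T : A →ₗ[ℂ] A) : A →ₗ[ℂ] A :=
  @LinearMap.adjoint ℂ A A _ h.normedAddCommGroup h.normedAddCommGroup
    h.innerProductSpace h.innerProductSpace _ _ T

/-- The adjoint `T† : l² ⊗ l² → l²` of a linear map `T : l² → l² ⊗ l²`. -/
noncomputable def daggerToTensor (h : IsFrobenius ψ) (T : A →ₗ[ℂ] A ⊗[ℂ] A) :
    A ⊗[ℂ] A →ₗ[ℂ] A :=
  @LinearMap.adjoint ℂ A (A ⊗[ℂ] A) _ h.normedAddCommGroup h.normedAddCommGroupTensor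
    h.innerProductSpace h.innerProductSpaceTensor _ _ T

/-- The adjoint `T† : l² → l² ⊗ l²` of a linear map `T : l² ⊗ l² → l²`. -/
noncomputable def daggerOfTensor (h : IsFrobenius ψ) (T : A ⊗[ℂ] A →ₗ[ℂ] A) :
    A →ₗ[ℂ] A ⊗[ℂ] A :=
  @LinearMap.adjoint ℂ (A ⊗[ℂ] A) A _ h.normedAddCommGroupTensor h.normedAddCommGroup
    h.innerProductSpaceTensor h.innerProductSpace _ _ T

/-- The vector `T†(1) ∈ l²` for a linear functional `T : l² → ℂ`. -/
noncomputable def daggerFunctional (h : IsFrobenius ψ) (T : A →ₗ[ℂ] ℂ) : A :=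
  @LinearMap.adjoint ℂ A ℂ _ h.normedAddCommGroup _
    h.innerProductSpace _ _ _ T 1

theorem dagger_spec (h : IsFrobenius ψ) (T : A →ₗ[ℂ] A) (x y : A) :
    ψ (star (h.dagger T x) * y) = ψ (star x * T y) :=
  @LinearMap.adjoint_inner_left ℂ A A _ h.normedAddCommGroup h.normedAddCommGroup
    h.innerProductSpace h.innerProductSpace _ _ T y x

theorem daggerToTensor_spec (h : IsFrobenius ψ) (T : A →ₗ[ℂ] A ⊗[ℂ] A) (s : A ⊗[ℂ] A) (x : A) :
    ψ (star (h.daggerToTensor T s) * x) =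
      LinearMap.mul' ℂ ℂ (TensorProduct.map ψ ψ (star s * T x)) := by
  rw [← h.inner_tensor]
  exact @LinearMap.adjoint_inner_left ℂ A (A ⊗[ℂ] A) _ h.normedAddCommGroup
    h.normedAddCommGroupTensor h.innerProductSpace h.innerProductSpaceTensor _ _ T x s

theorem daggerOfTensor_spec (h : IsFrobenius ψ) (T : A ⊗[ℂ] A →ₗ[ℂ] A) (x : A) (s : A ⊗[ℂ] A) :
    LinearMap.mul' ℂ ℂ (TensorProduct.map ψ ψ (star (h.daggerOfTensor T x) * s)) =
      ψ (star x * T s) := by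
  rw [← h.inner_tensor]
  exact @LinearMap.adjoint_inner_left ℂ (A ⊗[ℂ] A) A _ h.normedAddCommGroupTensor
    h.normedAddCommGroup h.innerProductSpaceTensor h.innerProductSpace _ _ T s x

theorem daggerFunctional_spec (h : IsFrobenius ψ) (T : A →ₗ[ℂ] ℂ) (x : A) :
    ψ (star (h.daggerFunctional T) * x) = T x := by
  have := @LinearMap.adjoint_inner_left ℂ A ℂ _ h.normedAddCommGroup _
    h.innerProductSpace _ _ _ T x 1
  exact this.trans (by simp)

end IsFrobenius

/-- The operator `J = η η†`, that is, `J a = ψ(a) 1`. -/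
noncomputable def opJ (ψ : A →ₗ[ℂ] ℂ) : A →ₗ[ℂ] A :=
  ψ.smulRight 1

variable [StarModule ℂ A]

/-- The involution `T^*` of operators on `l²(X)`, `T^*(a) = (T(a^*))^*`. -/
noncomputable def opStar (T : A →ₗ[ℂ] A) : A →ₗ[ℂ] A :=
  (star (WithConv.toConv T)).ofConv

theorem opStar_apply (T : A →ₗ[ℂ] A) (a : A) : opStar T a = star (T (star a)) := rfl

variable [FiniteDimensional ℂ A]

/-- `ψ` makes `A = C(X)` into a finite quantum space, that is, into a special (`m m† = id`)
symmetric (`ψ` is tracial) Frobenius `*`-algebra. Here `ψ = η†`, where `η` is the unit. -/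
structure IsQuantumSpace (ψ : A →ₗ[ℂ] ℂ) : Prop extends IsFrobenius ψ where
  symmetric : ∀ a b : A, ψ (a * b) = ψ (b * a)
  special : LinearMap.mul' ℂ A ∘ₗ toIsFrobenius.daggerOfTensor (LinearMap.mul' ℂ A) = LinearMap.id

namespace IsQuantumSpace

variable {ψ : A →ₗ[ℂ] ℂ}

/-- The Schur product `S • T = m (S ⊗ T) m†` of two operators on `l²(X)`. -/
noncomputable def schur (h : IsQuantumSpace ψ) (S T : A →ₗ[ℂ] A) : A →ₗ[ℂ] A :=
  LinearMap.mul' ℂ A ∘ₗ TensorProduct.map S T ∘ₗ h.daggerOfTensor (LinearMap.mul' ℂ A)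

end IsQuantumSpace

/-- A quantum coherent algebra over the finite quantum space `(A, ψ)`. -/
structure IsCoherent {ψ : A →ₗ[ℂ] ℂ} (h : IsQuantumSpace ψ)
    (𝒜 : Submodule ℂ (A →ₗ[ℂ] A)) : Prop where
  comp_mem : ∀ {S T}, S ∈ 𝒜 → T ∈ 𝒜 → S ∘ₗ T ∈ 𝒜
  schur_mem : ∀ {S T}, S ∈ 𝒜 → T ∈ 𝒜 → h.schur S T ∈ 𝒜
  dagger_mem : ∀ {T}, T ∈ 𝒜 → h.dagger T ∈ 𝒜
  star_mem : ∀ {T}, T ∈ 𝒜 → opStar T ∈ 𝒜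
  id_mem : LinearMap.id ∈ 𝒜
  opJ_mem : opJ ψ ∈ 𝒜

end FrobeniusAlgebras

section Duality

variable {A : Type u} [Ring A] [StarRing A] [Algebra ℂ A] [StarModule ℂ A] [FiniteDimensional ℂ A]
  {B : Type v} [Ring B] [StarRing B] [Algebra ℂ B] [StarModule ℂ B] [FiniteDimensional ℂ B]

/-- `Φ` exhibits the quantum coherent algebra `ℬ` over `(B, φ)` as dual to the quantum coherent
algebra `𝒜` over `(A, ψ)`, where both quantum spaces have the same dimension `n`. -/
structure IsDuality {ψ : A →ₗ[ℂ] ℂ} {φ : B →ₗ[ℂ] ℂ} {hψ : IsQuantumSpace ψ}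
    {hφ : IsQuantumSpace φ} {𝒜 : Submodule ℂ (A →ₗ[ℂ] A)} {ℬ : Submodule ℂ (B →ₗ[ℂ] B)}
    (h𝒜 : IsCoherent hψ 𝒜) (_hℬ : IsCoherent hφ ℬ) (Φ : 𝒜 ≃ₗ[ℂ] ℬ) : Prop where
  finrank_eq : Module.finrank ℂ A = Module.finrank ℂ B
  map_comp : ∀ S T : 𝒜, (Φ ⟨S.1 ∘ₗ T.1, h𝒜.comp_mem S.2 T.2⟩ : B →ₗ[ℂ] B) =
    (Module.finrank ℂ A : ℂ) • hφ.schur (Φ S).1 (Φ T).1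
  map_schur : ∀ S T : 𝒜, (Φ ⟨hψ.schur S.1 T.1, h𝒜.schur_mem S.2 T.2⟩ : B →ₗ[ℂ] B) =
    (Φ S).1 ∘ₗ (Φ T).1
  map_dagger : ∀ T : 𝒜, (Φ ⟨hψ.dagger T.1, h𝒜.dagger_mem T.2⟩ : B →ₗ[ℂ] B) = opStar (Φ T).1
  map_star : ∀ T : 𝒜, (Φ ⟨opStar T.1, h𝒜.star_mem T.2⟩ : B →ₗ[ℂ] B) = hφ.dagger (Φ T).1

end Duality

section QuantumGroups

open Coalgebra HopfAlgebra

/-- `A = C(Γ)` for a finite quantum group `Γ`: a finite-dimensional Hopf `*`-algebra over `ℂ` whose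
underlying `*`-algebra is a C*-algebra, i.e. is `*`-isomorphic to one. -/
class FiniteQuantumGroup (A : Type u) [Ring A] [StarRing A] [HopfAlgebra ℂ A] : Prop
    extends StarModule ℂ A, FiniteDimensional ℂ A where
  comul_star : ∀ a : A, comul (R := ℂ) (star a) = star (comul (R := ℂ) a)
  counit_star : ∀ a : A, counit (R := ℂ) (star a) = star (counit (R := ℂ) a)
  exists_cstarAlgebra : ∃ (C : Type u) (_ : CStarAlgebra C), Nonempty (A ≃⋆ₐ[ℂ] C)

variable {A : Type u} [Ring A] [StarRing A] [HopfAlgebra ℂ A] [FiniteQuantumGroup A]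
  {B : Type v} [Ring B] [StarRing B] [HopfAlgebra ℂ B] [FiniteQuantumGroup B]

/-- `ψ` is the Haar functional of `A = C(Γ)`, normalized so that it makes `A` into a special
symmetric Frobenius `*`-algebra. -/
structure IsHaar (ψ : A →ₗ[ℂ] ℂ) : Prop extends IsQuantumSpace ψ where
  left_invariant : ∀ a : A, TensorProduct.lid ℂ A (ψ.rTensor A (comul a)) = ψ a • (1 : A)

/-- The involution `x^⋆ = S(x^*)`, where `S` is the antipode. -/
noncomputable def costar (x : A) : A := antipode ℂ (star x)

namespace IsHaar

variable {ψ : A →ₗ[ℂ] ℂ}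

/-- The convolution product `x * y = Δ†(x ⊗ y)`, as a bilinear map. -/
noncomputable def conv (h : IsHaar ψ) : A →ₗ[ℂ] A →ₗ[ℂ] A :=
  TensorProduct.curry (h.daggerToTensor comul)

/-- The unit `ε†` of the convolution product. -/
noncomputable def convUnit (h : IsHaar ψ) : A :=
  h.daggerFunctional counit

/-- The weighted Cayley graph `A_x` of `Γ` with respect to `x`, that is, `A_x y = x * y`. -/
noncomputable def cayley (h : IsHaar ψ) : A →ₗ[ℂ] (A →ₗ[ℂ] A) := h.conv

theorem cayley_apply (h : IsHaar ψ) (x y : A) :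
    h.cayley x y = h.daggerToTensor comul (x ⊗ₜ[ℂ] y) := rfl

/-- A quantum Schur ring `S ⊆ l²(Γ)`. -/
structure IsSchurRing (h : IsHaar ψ) (S : Submodule ℂ A) : Prop where
  mul_mem : ∀ {x y}, x ∈ S → y ∈ S → x * y ∈ S
  conv_mem : ∀ {x y}, x ∈ S → y ∈ S → h.conv x y ∈ S
  star_mem : ∀ {x}, x ∈ S → star x ∈ S
  costar_mem : ∀ {x}, x ∈ S → costar x ∈ S
  one_mem : 1 ∈ S
  convUnit_mem : h.convUnit ∈ S

/-- The Bose-Mesner algebra `𝒜` of a quantum translation association scheme over `Γ`: a quantum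
coherent algebra contained in `{A_x | x ∈ l²(Γ)}`. -/
structure IsTranslationScheme (h : IsHaar ψ) (𝒜 : Submodule ℂ (A →ₗ[ℂ] A)) : Prop
    extends IsCoherent h.toIsQuantumSpace 𝒜 where
  le_range : 𝒜 ≤ LinearMap.range h.cayley

/-- The subspace `{A_x | x ∈ S}` of operators on `l²(Γ)`. -/
noncomputable def scheme (h : IsHaar ψ) (S : Submodule ℂ A) : Submodule ℂ (A →ₗ[ℂ] A) :=
  S.map h.cayley

/-- `B = C(Γ̂)` is the dual of `A = C(Γ)`, with Fourier transform `F : C(Γ) → C(Γ̂)`: the map `F`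
is an isomorphism onto the Hopf `*`-algebra `B` from the passive dual of `A`, which is the vector
space `A` with multiplication `Δ†`, unit `ε†`, comultiplication `m†`, counit `η† = ψ`, antipode `S`
and involution `x ↦ x^⋆`. -/
structure IsFourierTransform (h : IsHaar ψ) (F : A ≃ₗ[ℂ] B) : Prop where
  map_conv : ∀ x y : A, F (h.conv x y) = F x * F y
  map_convUnit : F h.convUnit = 1
  comul_map : ∀ x : A, comul (R := ℂ) (F x) =
    TensorProduct.map F.toLinearMap F.toLinearMap (h.daggerOfTensor (LinearMap.mul' ℂ A) x)
  counit_map : ∀ x : A, counit (R := ℂ) (F x) = ψ x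
  antipode_map : ∀ x : A, antipode ℂ (F x) = F (antipode ℂ x)
  star_map : ∀ x : A, star (F x) = F (costar x)

end IsHaar

end QuantumGroups

/-! The normalized Haar functional must be the trace `χ` of the left regular representation. In a
symmetric Frobenius algebra `m† x` is the kernel of left multiplication by `x`, and an operator with
kernel `t` has trace `ψ (m t)`. Hence `m m† = id` forces `ψ = χ` (`eq_regularTrace`). Conversely,
`χ` is positive and faithful by C*-spectral theory, special by the same computation, and invariant
(`leftSlice_regularTrace_comul`).

Invariance shows that `A_x` has kernel `∑ x₁ ⊗ S(x₂)` (`cayley_eq_sum`). From this kernel and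
associativity of convolution, `x ↦ A_x` sends convolution to composition, product to Schur product,
`⋆` to `†` and `*` to the operator `*`. So Schur rings give translation schemes.

The Fourier transform `F` sends convolution to product and `⋆` to `*` by definition. The converse
exchange comes from traces: left multiplication by `F x` is conjugate to `A_x`, whose trace is `n
ε(x)`. Hence `F` multiplies inner products by `n`, and taking adjoints of coproducts gives `F x * F
y = n F (x y)` for convolution on the left (`conv_map`). Both exchanges together give the duality,
and the factor `n⁻¹` in `Φ` balances this `n`.

For existence, the dual is the convolution algebra of functionals on `A`, with `F x = ψ(· x)`. Its
left regular representation on a Hilbert space makes it a C*-algebra. -/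

/-! ### Operator kernels and traces in Frobenius algebras -/

section FrobeniusLemmas

variable {A : Type u} [Ring A] [Algebra ℂ A]

/-- The functional `ψ ⊗ ψ` on `A ⊗ A`. -/
noncomputable def tensorSquare (ψ : A →ₗ[ℂ] ℂ) : A ⊗[ℂ] A →ₗ[ℂ] ℂ :=
  LinearMap.mul' ℂ ℂ ∘ₗ TensorProduct.map ψ ψ

@[simp]
theorem tensorSquare_tmul (ψ : A →ₗ[ℂ] ℂ) (a b : A) :
    tensorSquare ψ (a ⊗ₜ b) = ψ a * ψ b := rfl

/-- The operator on `A` with kernel `t`: the kernel `s ⊗ t` yields `y ↦ ψ (t * y) • s`. -/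
noncomputable def kernelOp (ψ : A →ₗ[ℂ] ℂ) : A ⊗[ℂ] A →ₗ[ℂ] (A →ₗ[ℂ] A) :=
  dualTensorHom ℂ A A ∘ₗ
    TensorProduct.map ((LinearMap.mul ℂ A).compr₂ ψ) LinearMap.id ∘ₗ
      (TensorProduct.comm ℂ A A).toLinearMap

@[simp]
theorem kernelOp_tmul (ψ : A →ₗ[ℂ] ℂ) (s t y : A) :
    kernelOp ψ (s ⊗ₜ t) y = ψ (t * y) • s := rfl

/-- A rank-one operator `y ↦ ψ (t * y) • s` has trace `ψ (t * s)`; symmetry of `ψ` turns this into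
`ψ (s * t)`. -/
theorem trace_kernelOp [FiniteDimensional ℂ A] (ψ : A →ₗ[ℂ] ℂ)
    (hψ : ∀ a b : A, ψ (a * b) = ψ (b * a)) (t : A ⊗[ℂ] A) :
    LinearMap.trace ℂ A (kernelOp ψ t) = ψ (LinearMap.mul' ℂ A t) := by
  induction t using TensorProduct.induction_on with
  | zero => simp
  | add s t hs ht => simp [hs, ht]
  | tmul s t =>
    have := LinearMap.trace_eq_contract_apply (R := ℂ) (M := A)
      ((LinearMap.mul ℂ A).compr₂ ψ t ⊗ₜ s)
    refine this.trans ?_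
    simp [hψ t s]

theorem apply_mul_kernelOp (ψ : A →ₗ[ℂ] ℂ) (hψ : ∀ a b : A, ψ (a * b) = ψ (b * a))
    (t : A ⊗[ℂ] A) (w y : A) :
    ψ (w * kernelOp ψ t y) = tensorSquare ψ ((w ⊗ₜ y) * t) := by
  induction t using TensorProduct.induction_on with
  | zero => simp
  | add s t hs ht => simp [mul_add, hs, ht]
  | tmul s t => simp [hψ t y, mul_comm]

theorem kernelOp_mul_left (ψ : A →ₗ[ℂ] ℂ) (t : A ⊗[ℂ] A) (w : A) :
    kernelOp ψ ((w ⊗ₜ 1) * t) = LinearMap.mulLeft ℂ w ∘ₗ kernelOp ψ t := by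
  induction t using TensorProduct.induction_on with
  | zero => simp
  | add s t hs ht => simp [mul_add, hs, ht, LinearMap.comp_add]
  | tmul s t => ext; simp

theorem mul'_mul_left (t : A ⊗[ℂ] A) (w : A) :
    LinearMap.mul' ℂ A ((w ⊗ₜ 1) * t) = w * LinearMap.mul' ℂ A t := by
  induction t using TensorProduct.induction_on with
  | zero => simp
  | add s t hs ht => simp [mul_add, hs, ht]
  | tmul s t => simp [mul_assoc]

variable (A) in
/-- The trace of the left regular representation. -/
noncomputable def regularTrace : A →ₗ[ℂ] ℂ :=
  LinearMap.trace ℂ A ∘ₗ LinearMap.mul ℂ A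

theorem regularTrace_apply (a : A) :
    regularTrace A a = LinearMap.trace ℂ A (LinearMap.mulLeft ℂ a) := rfl

theorem regularTrace_mul_comm (a b : A) : regularTrace A (a * b) = regularTrace A (b * a) := by
  rw [regularTrace_apply, regularTrace_apply, LinearMap.mulLeft_mul, LinearMap.mulLeft_mul,
    ← Module.End.mul_eq_comp, ← Module.End.mul_eq_comp, LinearMap.trace_mul_comm]

theorem regularTrace_one [FiniteDimensional ℂ A] :
    regularTrace A 1 = Module.finrank ℂ A := by
  rw [regularTrace_apply, LinearMap.mulLeft_one, LinearMap.trace_id]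

variable [StarRing A] {ψ : A →ₗ[ℂ] ℂ}

namespace IsFrobenius

theorem eq_of_forall_left (h : IsFrobenius ψ) {a b : A} (hab : ∀ w, ψ (w * a) = ψ (w * b)) :
    a = b := by
  rw [← sub_eq_zero]
  refine h.nondegenerate.2 _ fun w => ?_
  simp [mul_sub, hab w]

theorem of_definite (h0 : ∀ a : A, 0 ≤ ψ (star a * a)) (h1 : ∀ a : A, ψ (star a * a) = 0 → a = 0) :
    IsFrobenius ψ where
  positive := h0
  nondegenerate := by
    refine ⟨fun a ha => ?_, fun a ha => h1 a (ha (star a))⟩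
    have := ha (star a)
    have := h1 (star a) (by simpa using this)
    simpa using this

end IsFrobenius

variable [StarModule ℂ A]

theorem star_mul_tensor (s t : A ⊗[ℂ] A) : star (s * t) = star t * star s := by
  induction s using TensorProduct.induction_on with
  | zero => simp
  | add a b ha hb => simp [add_mul, mul_add, ha, hb]
  | tmul a b =>
    induction t using TensorProduct.induction_on with
    | zero => simp
    | add c d hc hd => simp [add_mul, mul_add, hc, hd]
    | tmul c d => simp

namespace IsFrobenius

theorem eq_zero_of_star_mul_self (h : IsFrobenius ψ) {a : A} (ha : ψ (star a * a) = 0) : a = 0 :=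
  h.core.definite a ha

theorem tensorSquare_star (h : IsFrobenius ψ) (t : A ⊗[ℂ] A) :
    tensorSquare ψ (star t) = star (tensorSquare ψ t) := by
  induction t using TensorProduct.induction_on with
  | zero => simp
  | add s t hs ht => simp [hs, ht]
  | tmul s t =>
    rw [TensorProduct.star_tmul, tensorSquare_tmul, tensorSquare_tmul, star_mul', h.conj_apply,
      h.conj_apply]

theorem tensorSquare_definite (h : IsFrobenius ψ) {t : A ⊗[ℂ] A}
    (ht : tensorSquare ψ (star t * t) = 0) : t = 0 := by
  let _ := h.normedAddCommGroup
  let _ := h.innerProductSpace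
  let _ := h.normedAddCommGroupTensor
  let _ := h.innerProductSpaceTensor
  have := h.inner_tensor t t
  rw [← inner_self_eq_zero (𝕜 := ℂ)]
  exact this.trans ht

variable [FiniteDimensional ℂ A]

theorem eq_dagger (h : IsFrobenius ψ) {T T' : A →ₗ[ℂ] A}
    (hT : ∀ x y, ψ (star (T' x) * y) = ψ (star x * T y)) : h.dagger T = T' := by
  ext x
  refine star_injective (sub_eq_zero.1 (h.nondegenerate.1 _ fun y => ?_))
  simp [h.dagger_spec, hT]

theorem apply_mul_daggerToTensor (h : IsFrobenius ψ) (T : A →ₗ[ℂ] A ⊗[ℂ] A) (w : A)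
    (s : A ⊗[ℂ] A) :
    ψ (w * h.daggerToTensor T s) = tensorSquare ψ (star (T (star w)) * s) := by
  have := h.daggerToTensor_spec T s (star w)
  have := congrArg star this
  rw [h.conj_apply, star_mul, star_star, star_star] at this
  rw [this]
  change star (tensorSquare ψ _) = _
  rw [← h.tensorSquare_star, star_mul_tensor, star_star]

theorem tensorSquare_mul_daggerOfTensor (h : IsFrobenius ψ) (T : A ⊗[ℂ] A →ₗ[ℂ] A) (x : A)
    (s : A ⊗[ℂ] A) :
    tensorSquare ψ (s * h.daggerOfTensor T x) = ψ (star (T (star s)) * x) := by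
  have := h.daggerOfTensor_spec T x (star s)
  have := congrArg star this
  rw [h.conj_apply, star_mul, star_star] at this
  rw [← this]
  change _ = star (tensorSquare ψ _)
  rw [← h.tensorSquare_star, star_mul_tensor, star_star, star_star]

theorem apply_daggerFunctional_mul (h : IsFrobenius ψ) (T : A →ₗ[ℂ] ℂ) (w : A) :
    ψ (w * h.daggerFunctional T) = star (T (star w)) := by
  rw [← h.daggerFunctional_spec T, h.conj_apply, star_mul, star_star, star_star]

theorem tensorSquare_tmul_mul_dagger_mul (h : IsFrobenius ψ) (a b x : A) :
    tensorSquare ψ ((a ⊗ₜ b) * h.daggerOfTensor (LinearMap.mul' ℂ A) x) = ψ (b * a * x) := by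
  rw [h.tensorSquare_mul_daggerOfTensor]
  simp

/-- Pairing `m† x` with `w ⊗ y` gives `ψ (y w x)`, which is `ψ (w x y)` by symmetry. This links `m†`
with the regular representation and thereby determines `ψ`. -/
theorem kernelOp_dagger_mul (h : IsFrobenius ψ) (hψ : ∀ a b : A, ψ (a * b) = ψ (b * a)) (x : A) :
    kernelOp ψ (h.daggerOfTensor (LinearMap.mul' ℂ A) x) = LinearMap.mulLeft ℂ x := by
  ext y
  refine h.eq_of_forall_left fun w => ?_
  rw [apply_mul_kernelOp ψ hψ, h.tensorSquare_tmul_mul_dagger_mul, LinearMap.mulLeft_apply,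
    mul_assoc, hψ, mul_assoc]

theorem isQuantumSpace_regularTrace (h : IsFrobenius (regularTrace A)) :
    IsQuantumSpace (regularTrace A) where
  toIsFrobenius := h
  symmetric := regularTrace_mul_comm
  special := by
    ext a
    refine h.eq_of_forall_left fun w => ?_
    -- `χ (w * m (m† a))` is the trace of the operator with kernel `(w ⊗ 1) * m† a`, which is `L_w
    -- L_a = L_{w a}`.
    rw [LinearMap.comp_apply, ← mul'_mul_left, ← trace_kernelOp _ regularTrace_mul_comm,
      kernelOp_mul_left, h.kernelOp_dagger_mul regularTrace_mul_comm, ← LinearMap.mulLeft_mul]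
    rfl

end IsFrobenius

variable [FiniteDimensional ℂ A]

namespace IsQuantumSpace

theorem eq_regularTrace (h : IsQuantumSpace ψ) : ψ = regularTrace A := by
  ext a
  rw [regularTrace_apply, ← h.toIsFrobenius.kernelOp_dagger_mul h.symmetric,
    trace_kernelOp ψ h.symmetric]
  exact congrArg ψ (LinearMap.congr_fun h.special a).symm

/-- The second legs multiply in reverse order because `m†` pairs with `s' ⊗ t'` through `t' * s'`.
This reversal later matches the antimultiplicativity of the antipode. -/
theorem schur_kernelOp (h : IsQuantumSpace ψ) (s s' t t' : A) :
    h.schur (kernelOp ψ (s ⊗ₜ s')) (kernelOp ψ (t ⊗ₜ t')) =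
      kernelOp ψ ((s * t) ⊗ₜ (t' * s')) := by
  ext y
  have key : ∀ u : A ⊗[ℂ] A, LinearMap.mul' ℂ A (TensorProduct.map (kernelOp ψ (s ⊗ₜ s'))
      (kernelOp ψ (t ⊗ₜ t')) u) = tensorSquare ψ ((s' ⊗ₜ t') * u) • (s * t) := by
    intro u
    induction u using TensorProduct.induction_on with
    | zero => simp
    | add a b ha hb => simp [mul_add, add_smul, ha, hb]
    | tmul a b => simp [smul_smul, mul_comm]
  rw [schur, LinearMap.comp_apply, LinearMap.comp_apply, key,
    h.toIsFrobenius.tensorSquare_tmul_mul_dagger_mul, kernelOp_tmul]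

theorem schur_sum_sum (h : IsQuantumSpace ψ) {ι κ : Type*} (s : Finset ι) (t : Finset κ)
    (f : ι → A →ₗ[ℂ] A) (g : κ → A →ₗ[ℂ] A) :
    h.schur (∑ i ∈ s, f i) (∑ j ∈ t, g j) = ∑ i ∈ s, ∑ j ∈ t, h.schur (f i) (g j) := by
  ext y
  simp only [schur, LinearMap.comp_apply, LinearMap.sum_apply]
  rw [← TensorProduct.mapBilinear_apply]
  simp only [map_sum, LinearMap.sum_apply, TensorProduct.mapBilinear_apply]
  exact Finset.sum_comm

theorem schur_smul_smul (h : IsQuantumSpace ψ) (c d : ℂ) (S T : A →ₗ[ℂ] A) :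
    h.schur (c • S) (d • T) = (c * d) • h.schur S T := by
  ext y
  simp [schur, TensorProduct.map_smul_left, TensorProduct.map_smul_right, smul_smul, mul_comm]

end IsQuantumSpace

end FrobeniusLemmas

/-! ### Positivity and faithfulness of the regular trace -/

section CStar

variable {A : Type u} [Ring A] [Algebra ℂ A]

theorem spectrum_star_mul_self_nonneg_of_starAlgEquiv [StarRing A] {C : Type*} [CStarAlgebra C] (e : A ≃⋆ₐ[ℂ] C)
    (a : A) {z : ℂ} (hz : z ∈ spectrum ℂ (star a * a)) : 0 ≤ z := by
  have h1 : z ∈ spectrum ℂ (star (e a) * e a) := by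
    rw [← map_star, ← map_mul]
    rwa [AlgEquiv.spectrum_eq e]
  have h2 := (IsSelfAdjoint.star_mul_self (e a)).spectrumRestricts
  rw [← h2.algebraMap_image] at h1
  obtain ⟨r, hr, rfl⟩ := h1
  have := spectrum_star_mul_self_nonneg r hr
  simpa using this

theorem eq_zero_of_spectrum_star_mul_self [StarRing A] {C : Type*} [CStarAlgebra C] (e : A ≃⋆ₐ[ℂ] C)
    (a : A) (ha : ∀ z ∈ spectrum ℂ (star a * a), z = 0) : a = 0 := by
  have h1 : star (e a) * e a = 0 := by
    refine CFC.eq_zero_of_spectrum_subset_zero (R := ℂ) (p := IsStarNormal) _ ?_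
      (IsSelfAdjoint.star_mul_self (e a)).isStarNormal
    rw [← map_star, ← map_mul, AlgEquiv.spectrum_eq e]
    exact ha
  have h2 := CStarRing.star_mul_self_eq_zero_iff (e a) |>.1 h1
  simpa using h2

/-- Left multiplication by `b` is bijective exactly when `b` is a unit: a preimage `c` of `1` is a
right inverse, and injectivity applied to `b * (c * b) = b * 1` makes it a left inverse. -/
theorem spectrum_mulLeft [FiniteDimensional ℂ A] (a : A) : spectrum ℂ (LinearMap.mulLeft ℂ a) = spectrum ℂ a := by
  ext z
  rw [not_iff_not.symm, spectrum.notMem_iff, spectrum.notMem_iff]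
  have : algebraMap ℂ (Module.End ℂ A) z - LinearMap.mulLeft ℂ a =
      LinearMap.mulLeft ℂ (algebraMap ℂ A z - a) := by
    ext; simp [sub_mul, Algebra.smul_def]
  rw [this]
  set b := algebraMap ℂ A z - a
  constructor
  · intro hb
    obtain ⟨hi, hs⟩ := (Module.End.isUnit_iff _).1 hb
    obtain ⟨c, hc⟩ := hs 1
    rw [LinearMap.mulLeft_apply] at hc
    refine ⟨⟨b, c, hc, hi ?_⟩, rfl⟩
    simp [← mul_assoc, hc]
  · rintro ⟨b, hb⟩
    rw [← hb]
    exact ⟨⟨LinearMap.mulLeft ℂ (b : A), LinearMap.mulLeft ℂ ((b⁻¹ : Aˣ) : A),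
      by ext; simp, by ext; simp⟩, rfl⟩

variable [FiniteDimensional ℂ A]

theorem regularTrace_eq_sum_roots (a : A) :
    regularTrace A a = (LinearMap.mulLeft ℂ a).charpoly.roots.sum :=
  Module.End.trace_eq_sum_roots_charpoly_of_splits (IsAlgClosed.splits _)

theorem mem_roots_charpoly_mulLeft (a : A) (z : ℂ) :
    z ∈ (LinearMap.mulLeft ℂ a).charpoly.roots ↔ z ∈ spectrum ℂ a := by
  rw [← spectrum_mulLeft, Module.End.mem_spectrum_iff_isRoot_charpoly, Polynomial.mem_roots']
  exact and_iff_right (LinearMap.charpoly_monic _).ne_zero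

variable [StarRing A]

/-- The trace of `L_{a^* a}` is the sum of its eigenvalues, which form the spectrum of `a^* a` and
so are nonnegative. If the sum vanishes, every eigenvalue does, and a self-adjoint element of a
C*-algebra with spectrum `{0}` is zero. -/
theorem isFrobenius_regularTrace [StarModule ℂ A] {C : Type*} [CStarAlgebra C] (e : A ≃⋆ₐ[ℂ] C) :
    IsFrobenius (regularTrace A) := by
  have key (a : A) : ∀ z ∈ (LinearMap.mulLeft ℂ (star a * a)).charpoly.roots, 0 ≤ z :=
    fun z hz => spectrum_star_mul_self_nonneg_of_starAlgEquiv e a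
      ((mem_roots_charpoly_mulLeft _ _).1 hz)
  refine .of_definite (fun a => ?_) fun a ha => ?_
  · rw [regularTrace_eq_sum_roots]
    exact Multiset.sum_nonneg (key a)
  · rw [regularTrace_eq_sum_roots] at ha
    refine eq_zero_of_spectrum_star_mul_self e a fun z hz => ?_
    have hz := (mem_roots_charpoly_mulLeft _ _).2 hz
    refine le_antisymm ?_ (key a z hz)
    rw [← ha]
    exact Multiset.single_le_sum (key a) z hz

end CStar

/-! ### Slice maps on the tensor square -/

section Slices

variable {A : Type u} [Ring A] [Algebra ℂ A]

/-- The slice map `f ⊗ id`. -/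
noncomputable def leftSlice (f : A →ₗ[ℂ] ℂ) : A ⊗[ℂ] A →ₗ[ℂ] A :=
  (TensorProduct.lid ℂ A).toLinearMap ∘ₗ f.rTensor A

/-- The slice map `id ⊗ f`. -/
noncomputable def rightSlice (f : A →ₗ[ℂ] ℂ) : A ⊗[ℂ] A →ₗ[ℂ] A :=
  (TensorProduct.rid ℂ A).toLinearMap ∘ₗ f.lTensor A

@[simp]
theorem leftSlice_tmul (f : A →ₗ[ℂ] ℂ) (a b : A) : leftSlice f (a ⊗ₜ b) = f a • b := rfl

@[simp]
theorem rightSlice_tmul (f : A →ₗ[ℂ] ℂ) (a b : A) : rightSlice f (a ⊗ₜ b) = f b • a := rfl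

theorem apply_leftSlice (f g : A →ₗ[ℂ] ℂ) (t : A ⊗[ℂ] A) :
    g (leftSlice f t) = LinearMap.mul' ℂ ℂ (TensorProduct.map f g t) := by
  induction t using TensorProduct.induction_on with
  | zero => simp
  | add s t hs ht => simp [hs, ht]
  | tmul s t => simp

theorem leftSlice_mul_one_tmul (f : A →ₗ[ℂ] ℂ) (t : A ⊗[ℂ] A) (b : A) :
    leftSlice f (t * (1 ⊗ₜ b)) = leftSlice f t * b := by
  induction t using TensorProduct.induction_on with
  | zero => simp
  | add s t hs ht => simp [add_mul, hs, ht]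
  | tmul s t => simp

theorem leftSlice_one_tmul_mul (f : A →ₗ[ℂ] ℂ) (t : A ⊗[ℂ] A) (b : A) :
    leftSlice f ((1 ⊗ₜ b) * t) = b * leftSlice f t := by
  induction t using TensorProduct.induction_on with
  | zero => simp
  | add s t hs ht => simp [mul_add, hs, ht]
  | tmul s t => simp

variable [StarRing A] [StarModule ℂ A] {ψ : A →ₗ[ℂ] ℂ}

theorem IsFrobenius.leftSlice_star (h : IsFrobenius ψ) (t : A ⊗[ℂ] A) :
    leftSlice ψ (star t) = star (leftSlice ψ t) := by
  induction t using TensorProduct.induction_on with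
  | zero => simp
  | add s t hs ht => simp [hs, ht]
  | tmul s t => simp only [TensorProduct.star_tmul, leftSlice_tmul, star_smul, h.conj_apply]

end Slices

/-! ### Convolution identities for the antipode and the trace of a coproduct -/

section HopfAlgebras

open Coalgebra HopfAlgebra WithConv

variable {A : Type u} [Ring A] [HopfAlgebra ℂ A]

theorem includeLeft_convMul_includeRight :
    toConv (Algebra.TensorProduct.includeLeft : A →ₐ[ℂ] A ⊗[ℂ] A).toLinearMap *
      toConv (Algebra.TensorProduct.includeRight : A →ₐ[ℂ] A ⊗[ℂ] A).toLinearMap =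
        toConv (comul (R := ℂ)) := by
  ext a
  rw [(ℛ ℂ a).convMul_apply]
  simp [(ℛ ℂ a).eq]

theorem algHom_convMul_antipode {B : Type*} [Ring B] [Algebra ℂ B] (f : A →ₐ[ℂ] B) :
    toConv f.toLinearMap * toConv (f.toLinearMap ∘ₗ antipode ℂ) = 1 := by
  have := LinearMap.algHom_comp_convMul_distrib f (toConv LinearMap.id) (toConv (antipode ℂ))
  rw [LinearMap.id_mul_antipode] at this
  apply ofConv_injective
  refine this.symm.trans ?_
  ext; simp

theorem antipode_convMul_algHom {B : Type*} [Ring B] [Algebra ℂ B] (f : A →ₐ[ℂ] B) :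
    toConv (f.toLinearMap ∘ₗ antipode ℂ) * toConv f.toLinearMap = 1 := by
  have := LinearMap.algHom_comp_convMul_distrib f (toConv (antipode ℂ)) (toConv LinearMap.id)
  rw [LinearMap.antipode_mul_id] at this
  apply ofConv_injective
  refine this.symm.trans ?_
  ext; simp

theorem sum_comul_mul_one_tmul_antipode {ι : Type*} {a : A} (r : Coalgebra.Repr ℂ a ι) :
    ∑ i ∈ r.index, comul (R := ℂ) (r.left i) * (1 ⊗ₜ antipode ℂ (r.right i)) = a ⊗ₜ 1 := by
  have : toConv (comul (R := ℂ)) * toConv ((Algebra.TensorProduct.includeRight :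
      A →ₐ[ℂ] A ⊗[ℂ] A).toLinearMap ∘ₗ antipode ℂ) =
      toConv (Algebra.TensorProduct.includeLeft : A →ₐ[ℂ] A ⊗[ℂ] A).toLinearMap := by
    rw [← includeLeft_convMul_includeRight, mul_assoc, algHom_convMul_antipode, mul_one]
  have := congrArg (fun f => f a) this
  rw [r.convMul_apply] at this
  exact this

/-- Both sides are convolution inverses of `Δ`: one from the right, since `Δ` is an algebra map, the
other from the left, since `Δ` is the convolution of the two inclusions of `A` in `A ⊗ A`. -/
theorem comul_antipode (a : A) :
    comul (R := ℂ) (antipode ℂ a) =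
      TensorProduct.map (antipode ℂ) (antipode ℂ) (TensorProduct.comm ℂ A A (comul a)) := by
  obtain ⟨iL, hL⟩ : ∃ f, f = (Algebra.TensorProduct.includeLeft : A →ₐ[ℂ] A ⊗[ℂ] A) := ⟨_, rfl⟩
  obtain ⟨iR, hR⟩ : ∃ f, f = (Algebra.TensorProduct.includeRight : A →ₐ[ℂ] A ⊗[ℂ] A) := ⟨_, rfl⟩
  have h1 : toConv (iR.toLinearMap ∘ₗ antipode ℂ) * toConv (iL.toLinearMap ∘ₗ antipode ℂ) *
      toConv (comul (R := ℂ)) = 1 := by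
    rw [← includeLeft_convMul_includeRight, ← hL, ← hR, mul_assoc,
      ← mul_assoc (toConv (iL.toLinearMap ∘ₗ antipode ℂ)), antipode_convMul_algHom iL, one_mul,
      antipode_convMul_algHom]
  have h2 := left_inv_eq_right_inv h1 LinearMap.comul_right_inv
  have h3 := congrArg (fun f => f a) h2
  rw [(ℛ ℂ a).convMul_apply] at h3
  rw [← (ℛ ℂ a).eq, map_sum, map_sum]
  refine h3.symm.trans (Finset.sum_congr rfl fun i _ => ?_)
  simp [hL, hR]

/-- The map `b ⊗ v ↦ Δ(b)(1 ⊗ v)` is invertible and conjugates `L_a ⊗ id` to left multiplication by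
`Δ(a)`. Comparing traces gives the factor `n = Tr id`. -/
theorem regularTrace_comul [FiniteDimensional ℂ A] (a : A) :
    tensorSquare (regularTrace A) (comul a) = Module.finrank ℂ A * regularTrace A a := by
  have key : ∀ t : A ⊗[ℂ] A, tensorSquare (regularTrace A) t =
      LinearMap.trace ℂ (A ⊗[ℂ] A) (LinearMap.mulLeft ℂ t) := by
    intro t
    induction t using TensorProduct.induction_on with
    | zero => simp
    | add s t hs ht =>
      have : LinearMap.mulLeft ℂ (s + t) = LinearMap.mulLeft ℂ s + LinearMap.mulLeft ℂ t := by
        ext; simp [add_mul]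
      rw [this, map_add, map_add, hs, ht]
    | tmul s t =>
      have : LinearMap.mulLeft ℂ (s ⊗ₜ[ℂ] t) =
          TensorProduct.map (LinearMap.mulLeft ℂ s) (LinearMap.mulLeft ℂ t) := by
        ext; simp
      rw [this, LinearMap.trace_tensorProduct']
      rfl
  let W : A ⊗[ℂ] A →ₗ[ℂ] A ⊗[ℂ] A := TensorProduct.lift
    (((LinearMap.mul ℂ (A ⊗[ℂ] A)).compl₁₂ comul
      (Algebra.TensorProduct.includeRight : A →ₐ[ℂ] A ⊗[ℂ] A).toLinearMap))
  have hW (b v : A) : W (b ⊗ₜ v) = comul b * (1 ⊗ₜ v) := rfl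
  have hsurj : Function.Surjective W := by
    rw [← LinearMap.range_eq_top, eq_top_iff, ← TensorProduct.span_tmul_eq_top, Submodule.span_le]
    rintro _ ⟨b, v, rfl⟩
    -- The preimage `∑ b₁ ⊗ S(b₂) v` comes from `∑ Δ(b₁)(1 ⊗ S(b₂)) = b ⊗ 1`. Surjectivity suffices
    -- in finite dimension.
    refine ⟨∑ i ∈ (ℛ ℂ b).index, (ℛ ℂ b).left i ⊗ₜ (antipode ℂ ((ℛ ℂ b).right i) * v), ?_⟩
    have : ∀ c d : A, comul (R := ℂ) c * (1 ⊗ₜ (d * v)) = comul c * (1 ⊗ₜ d) * (1 ⊗ₜ v) := by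
      intro c d
      rw [mul_assoc, Algebra.TensorProduct.tmul_mul_tmul, one_mul]
    simp only [map_sum, hW, this, ← Finset.sum_mul, sum_comul_mul_one_tmul_antipode]
    simp
  let e := LinearEquiv.ofBijective W ⟨(LinearMap.injective_iff_surjective).2 hsurj, hsurj⟩
  have hconj : LinearMap.mulLeft ℂ (comul (R := ℂ) a) =
      e.conj (TensorProduct.map (LinearMap.mulLeft ℂ a) LinearMap.id) := by
    refine LinearMap.ext fun t => ?_
    obtain ⟨s, rfl⟩ := e.surjective t
    rw [LinearEquiv.conj_apply_apply, e.symm_apply_apply]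
    change comul a * W s = W _
    induction s using TensorProduct.induction_on with
    | zero => simp
    | add s t hs ht => simp only [map_add, mul_add, hs, ht]
    | tmul b v => simp [hW, mul_assoc]
  rw [key, hconj, LinearMap.trace_conj', LinearMap.trace_tensorProduct', LinearMap.trace_id,
    mul_comm]
  rfl

end HopfAlgebras

/-! ### The Haar functional, the antipode and the kernel of a Cayley operator -/

section QuantumGroupLemmas

open Coalgebra HopfAlgebra

section Coalgebras

variable {A : Type u} [Ring A] [HopfAlgebra ℂ A]

theorem leftSlice_counit_comul (a : A) : leftSlice (counit (R := ℂ)) (comul a) = a := by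
  simp [leftSlice]

theorem rightSlice_counit_comul (a : A) : rightSlice (counit (R := ℂ)) (comul a) = a := by
  simp [rightSlice]

/-- By coassociativity, successive slices of coproducts amount to one slice by the convolution of
the functionals. -/
theorem leftSlice_comul_leftSlice (f g : A →ₗ[ℂ] ℂ) (a : A) :
    leftSlice f (comul (leftSlice g (comul a))) =
      leftSlice (LinearMap.mul' ℂ ℂ ∘ₗ TensorProduct.map g f ∘ₗ comul) (comul a) := by
  let Θ : A ⊗[ℂ] (A ⊗[ℂ] A) →ₗ[ℂ] A :=
    (TensorProduct.lid ℂ A).toLinearMap ∘ₗ TensorProduct.map g (leftSlice f)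
  have h1 : ∀ t : A ⊗[ℂ] A,
      leftSlice f (comul (leftSlice g t)) = Θ (comul.lTensor A t) := by
    intro t
    induction t using TensorProduct.induction_on with
    | zero => simp
    | add s t hs ht => simp only [map_add, hs, ht]
    | tmul s t => simp [Θ]
  have h2 : ∀ (s : A ⊗[ℂ] A) (q : A), LinearMap.mul' ℂ ℂ (TensorProduct.map g f s) • q =
      Θ (TensorProduct.assoc ℂ A A A (s ⊗ₜ q)) := by
    intro s q
    induction s using TensorProduct.induction_on with
    | zero => simp
    | add s t hs ht => simp only [map_add, TensorProduct.add_tmul, add_smul, hs, ht]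
    | tmul s t => simp [Θ, smul_smul, mul_comm]
  have h3 : ∀ t : A ⊗[ℂ] A,
      leftSlice (LinearMap.mul' ℂ ℂ ∘ₗ TensorProduct.map g f ∘ₗ comul) t =
        Θ (TensorProduct.assoc ℂ A A A (comul.rTensor A t)) := by
    intro t
    induction t using TensorProduct.induction_on with
    | zero => simp
    | add s t hs ht => simp only [map_add, hs, ht]
    | tmul s t => exact h2 _ _
  rw [h1, h3, coassoc_apply]

variable (A) in
theorem one_ne_zero_of_hopfAlgebra : (1 : A) ≠ 0 := by
  intro h
  have := congrArg (counit (R := ℂ)) h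
  simp at this

variable (A) in
theorem finrank_ne_zero_of_hopfAlgebra [FiniteDimensional ℂ A] :
    (Module.finrank ℂ A : ℂ) ≠ 0 := by
  have : Nontrivial A := ⟨1, 0, one_ne_zero_of_hopfAlgebra A⟩
  exact_mod_cast (Module.finrank_pos (R := ℂ) (M := A)).ne'

end Coalgebras

variable {A : Type u} [Ring A] [StarRing A] [HopfAlgebra ℂ A] [FiniteQuantumGroup A]

namespace FiniteQuantumGroup

variable (A) in
theorem isFrobenius_regularTrace : IsFrobenius (regularTrace A) := by
  obtain ⟨C, _, ⟨e⟩⟩ := FiniteQuantumGroup.exists_cstarAlgebra (A := A)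
  exact _root_.isFrobenius_regularTrace e

/-- Put `b = (χ ⊗ id)Δ(a)`. Since `χ` convolved with itself is `n χ`, one has `(χ ⊗ id)Δ(b) = n b`.
Then `Δ(b) - 1 ⊗ b` has norm zero, which forces `b` to be a scalar; applying `χ` identifies the
scalar as `χ a`. -/
theorem leftSlice_regularTrace_comul (a : A) :
    leftSlice (regularTrace A) (comul a) = regularTrace A a • (1 : A) := by
  have h := isFrobenius_regularTrace A
  have hn := finrank_ne_zero_of_hopfAlgebra A
  set χ := regularTrace A with hχ
  set b := leftSlice χ (comul a) with hb
  have hconv : LinearMap.mul' ℂ ℂ ∘ₗ TensorProduct.map χ χ ∘ₗ comul =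
      (Module.finrank ℂ A : ℂ) • χ := by
    ext c
    exact regularTrace_comul c
  have hsq (t : A ⊗[ℂ] A) : tensorSquare χ t = χ (leftSlice χ t) := (apply_leftSlice _ _ _).symm
  have hχb (c : A) : χ (leftSlice χ (comul c)) = Module.finrank ℂ A * χ c := by
    rw [← hsq]
    exact regularTrace_comul c
  have hbb : leftSlice χ (comul b) = (Module.finrank ℂ A : ℂ) • b := by
    rw [hb, leftSlice_comul_leftSlice, hconv]
    simp [leftSlice, LinearMap.rTensor_smul]
  have hsb : leftSlice χ (comul (star b)) = (Module.finrank ℂ A : ℂ) • star b := by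
    rw [comul_star, h.leftSlice_star, hbb, star_smul]
    simp
  have hprim : comul (R := ℂ) b = 1 ⊗ₜ b := by
    rw [← sub_eq_zero]
    apply h.tensorSquare_definite
    -- Each of the four terms has `χ ⊗ χ`-value `n χ (b^* b)`, with signs that cancel.
    have e1 : star (comul (R := ℂ) b - 1 ⊗ₜ b) * (comul (R := ℂ) b - 1 ⊗ₜ b) =
        comul (star b * b) - comul (star b) * (1 ⊗ₜ b) - (1 ⊗ₜ star b) * comul b +
          1 ⊗ₜ (star b * b) := by
      rw [star_sub, ← comul_star, TensorProduct.star_tmul, star_one, sub_mul, mul_sub, mul_sub,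
        Bialgebra.comul_mul, Algebra.TensorProduct.tmul_mul_tmul, one_mul]
      abel
    rw [e1, hsq]
    simp only [map_add, map_sub, leftSlice_mul_one_tmul, leftSlice_one_tmul_mul, hbb, hsb, hχb,
      leftSlice_tmul]
    rw [hχ, regularTrace_one]
    simp
  have hscal : b = counit (R := ℂ) b • (1 : A) := by
    conv_lhs => rw [← rightSlice_counit_comul b, hprim]
    simp
  have := congrArg χ hscal
  rw [hb, hχb, map_smul, hχ, regularTrace_one, smul_eq_mul, mul_comm] at this
  rw [hscal, mul_right_cancel₀ hn this]

variable (A) in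
theorem isHaar_regularTrace : IsHaar (regularTrace A) where
  toIsQuantumSpace := (isFrobenius_regularTrace A).isQuantumSpace_regularTrace
  left_invariant := leftSlice_regularTrace_comul

variable (A) in
theorem existsUnique_isHaar : ∃! ψ : A →ₗ[ℂ] ℂ, IsHaar ψ :=
  ⟨regularTrace A, isHaar_regularTrace A, fun _ h => h.toIsQuantumSpace.eq_regularTrace⟩

/-- The map `a ↦ S(S(a^*)^*)` is a right convolution inverse of `S`, while the identity is a left
one, so they coincide. -/
theorem antipode_star_antipode_star (a : A) :
    antipode ℂ (star (antipode ℂ (star a))) = a := by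
  have h : WithConv.toConv (antipode ℂ) *
      WithConv.toConv (antipode ℂ ∘ₗ opStar (antipode ℂ (A := A))) = 1 := by
    ext a
    have hs : ∑ i ∈ (ℛ ℂ a).index, star ((ℛ ℂ a).left i) ⊗ₜ[ℂ] star ((ℛ ℂ a).right i) =
        comul (star a) := by
      rw [comul_star, ← (ℛ ℂ a).eq, star_sum]
      rfl
    have h1 := sum_mul_antipode_eq_algebraMap_counit (⟨(ℛ ℂ a).index, _, _, hs⟩ :
      Coalgebra.Repr ℂ (star a) _)
    have h2 := congrArg (fun x => antipode ℂ (star x)) h1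
    simp only [star_sum, map_sum, star_mul, star_star, antipode_mul_antidistrib] at h2
    rw [(ℛ ℂ a).convMul_apply]
    refine h2.trans ?_
    simp [counit_star, Algebra.algebraMap_eq_smul_one]
  have h2 := left_inv_eq_right_inv LinearMap.id_mul_antipode h
  exact (congrArg (fun f => f a) h2).symm

end FiniteQuantumGroup

namespace IsHaar

variable {ψ : A →ₗ[ℂ] ℂ}

theorem apply_one (h : IsHaar ψ) : ψ 1 = Module.finrank ℂ A := by
  rw [h.toIsQuantumSpace.eq_regularTrace, regularTrace_one]

/-- Writing `x ⊗ 1 = ∑ Δ(x₁)(1 ⊗ S(x₂))` turns the argument into `∑ Δ(w x₁)(1 ⊗ S(x₂))`, to which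
invariance applies. -/
theorem leftSlice_comul_mul (h : IsHaar ψ) (w x : A) :
    leftSlice ψ (comul w * (x ⊗ₜ 1)) = antipode ℂ (leftSlice ψ ((w ⊗ₜ 1) * comul x)) := by
  have h1 (a : A) : leftSlice ψ (comul a) = ψ a • (1 : A) := h.left_invariant a
  rw [← sum_comul_mul_one_tmul_antipode (ℛ ℂ x)]
  conv_rhs => rw [← (ℛ ℂ x).eq]
  simp only [Finset.mul_sum, map_sum, ← mul_assoc, ← Bialgebra.comul_mul,
    leftSlice_mul_one_tmul, h1, Algebra.TensorProduct.tmul_mul_tmul, leftSlice_tmul, map_smul,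
    one_mul, smul_mul_assoc]

theorem apply_mul_convUnit (h : IsHaar ψ) (w : A) : ψ (w * h.convUnit) = counit (R := ℂ) w := by
  rw [convUnit, h.toIsFrobenius.apply_daggerFunctional_mul, FiniteQuantumGroup.counit_star,
    star_star]

/-- Slicing against `ε†` recovers `x`. Each use of `leftSlice_comul_mul` exchanges `x` and `ε†` at
the cost of one `S`, and traciality restores the order of factors. Two exchanges give `S² x = x`. -/
theorem antipode_antipode (h : IsHaar ψ) (x : A) : antipode ℂ (antipode ℂ x) = x := by
  have hswap (w t : A) : leftSlice ψ (comul w * (t ⊗ₜ 1)) = leftSlice ψ ((t ⊗ₜ 1) * comul w) := by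
    rw [← (ℛ ℂ w).eq]
    simp [Finset.mul_sum, Finset.sum_mul, h.symmetric t]
  have hx : leftSlice ψ ((h.convUnit ⊗ₜ 1) * comul x) = x := by
    conv_rhs => rw [← leftSlice_counit_comul x]
    rw [← (ℛ ℂ x).eq]
    simp [Finset.mul_sum, h.symmetric h.convUnit, h.apply_mul_convUnit]
  conv_rhs => rw [← hx, ← hswap, h.leftSlice_comul_mul, ← hswap, h.leftSlice_comul_mul, hx]

theorem antipode_star (h : IsHaar ψ) (x : A) : antipode ℂ (star x) = star (antipode ℂ x) := by
  have := FiniteQuantumGroup.antipode_star_antipode_star x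
  have := congrArg (antipode ℂ) this
  rw [h.antipode_antipode] at this
  rw [← this, star_star]

theorem costar_costar (h : IsHaar ψ) (x : A) : costar (costar x) = x := by
  rw [costar, costar, ← h.antipode_star, star_star, h.antipode_antipode]

theorem apply_mul_conv (h : IsHaar ψ) (w x y : A) :
    ψ (w * h.conv x y) = tensorSquare ψ (comul w * (x ⊗ₜ y)) := by
  have := h.toIsFrobenius.apply_mul_daggerToTensor comul w (x ⊗ₜ y)
  rwa [FiniteQuantumGroup.comul_star, star_star] at this

/-- Testing against `w` gives `(ψ ⊗ ψ)(Δ(w)(x ⊗ y))`, and `leftSlice_comul_mul` moves the coproduct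
from `w` to `x`. -/
theorem cayley_eq_sum (h : IsHaar ψ) {ι : Type*} {x : A} (r : Coalgebra.Repr ℂ x ι) :
    h.cayley x = ∑ i ∈ r.index, kernelOp ψ (r.left i ⊗ₜ antipode ℂ (r.right i)) := by
  ext y
  refine h.toIsFrobenius.eq_of_forall_left fun w => ?_
  have h1 : (x ⊗ₜ[ℂ] y : A ⊗[ℂ] A) = (x ⊗ₜ 1) * (1 ⊗ₜ y) := by simp
  rw [cayley, apply_mul_conv, h1, ← mul_assoc]
  have h2 (t : A ⊗[ℂ] A) : tensorSquare ψ t = ψ (leftSlice ψ t) := (apply_leftSlice _ _ _).symm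
  rw [h2, leftSlice_mul_one_tmul, h.leftSlice_comul_mul, ← r.eq]
  simp [Finset.mul_sum, Finset.sum_mul, mul_comm]

theorem conv_eq_sum (h : IsHaar ψ) {ι : Type*} {x : A} (r : Coalgebra.Repr ℂ x ι) (y : A) :
    h.conv x y = ∑ i ∈ r.index, ψ (antipode ℂ (r.right i) * y) • r.left i := by
  have := LinearMap.congr_fun (h.cayley_eq_sum r) y
  rw [LinearMap.sum_apply] at this
  exact this

theorem counit_conv (h : IsHaar ψ) (x y : A) :
    counit (R := ℂ) (h.conv x y) = ψ (antipode ℂ x * y) := by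
  rw [h.conv_eq_sum (ℛ ℂ x)]
  conv_rhs => rw [← leftSlice_counit_comul x, ← (ℛ ℂ x).eq]
  simp [Finset.sum_mul, mul_comm]

/-- This expresses the inner product through the passive dual structure alone, so the Fourier
transform can carry it over. -/
theorem counit_conv_costar (h : IsHaar ψ) (x y : A) :
    counit (R := ℂ) (h.conv (costar x) y) = ψ (star x * y) := by
  rw [counit_conv, costar, h.antipode_antipode]

/-- The kernel `∑ x₁ ⊗ S(x₂)` multiplies to `ε(x) 1`, and `ψ 1 = n`. -/
theorem trace_cayley (h : IsHaar ψ) (x : A) :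
    LinearMap.trace ℂ A (h.cayley x) = Module.finrank ℂ A * counit (R := ℂ) x := by
  rw [h.cayley_eq_sum (ℛ ℂ x), map_sum]
  simp only [trace_kernelOp ψ h.symmetric, LinearMap.mul'_apply, ← map_sum]
  rw [sum_mul_antipode_eq_smul, map_smul, h.apply_one, smul_eq_mul, mul_comm]

/-- The coproduct of `costar x` in terms of a coproduct of `x`. -/
noncomputable def reprCostar (h : IsHaar ψ) {ι : Type*} {x : A} (r : Coalgebra.Repr ℂ x ι) :
    Coalgebra.Repr ℂ (costar x) ι where
  index := r.index
  left i := star (antipode ℂ (r.right i))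
  right i := star (antipode ℂ (r.left i))
  eq := by
    rw [costar, comul_antipode, FiniteQuantumGroup.comul_star, ← r.eq, star_sum]
    simp [h.antipode_star]

theorem comul_sum_star {ι : Type*} {x : A} (r : Coalgebra.Repr ℂ x ι) :
    ∑ i ∈ r.index, star (r.left i) ⊗ₜ[ℂ] star (r.right i) = comul (star x) := by
  rw [FiniteQuantumGroup.comul_star, ← r.eq, star_sum]
  rfl

end IsHaar

end QuantumGroupLemmas

/-! ### Schur rings give translation schemes -/

section TranslationSchemes

open Coalgebra HopfAlgebra

variable {A : Type u} [Ring A] [StarRing A] [HopfAlgebra ℂ A] [FiniteQuantumGroup A]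

namespace IsHaar

variable {ψ : A →ₗ[ℂ] ℂ}

/-- The map `x ↦ ψ(· x)` to the dual of `A`. -/
noncomputable def toDual (_ : IsHaar ψ) : A →ₗ[ℂ] WithConv (A →ₗ[ℂ] ℂ) :=
  (WithConv.linearEquiv ℂ (A →ₗ[ℂ] ℂ)).symm.toLinearMap ∘ₗ
    ((LinearMap.mul ℂ A).compr₂ ψ).flip

@[simp]
theorem toDual_apply (h : IsHaar ψ) (x w : A) : h.toDual x w = ψ (w * x) := rfl

theorem toDual_injective (h : IsHaar ψ) : Function.Injective h.toDual := fun _ _ hxy =>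
  h.toIsFrobenius.eq_of_forall_left fun w => congrArg (fun f => f w) hxy

/-- Convolution on `l²` becomes the product dual to `Δ`, so its associativity and unit laws are
inherited from the functionals. -/
theorem toDual_conv (h : IsHaar ψ) (x y : A) : h.toDual (h.conv x y) = h.toDual x * h.toDual y := by
  ext w
  rw [h.toDual_apply, h.apply_mul_conv, (ℛ ℂ w).convMul_apply, ← (ℛ ℂ w).eq, Finset.sum_mul,
    map_sum]
  simp

theorem toDual_convUnit (h : IsHaar ψ) : h.toDual h.convUnit = 1 := by
  ext w
  exact h.apply_mul_convUnit w

theorem conv_assoc (h : IsHaar ψ) (x y z : A) :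
    h.conv (h.conv x y) z = h.conv x (h.conv y z) := by
  apply h.toDual_injective
  simp only [toDual_conv, mul_assoc]

theorem convUnit_conv (h : IsHaar ψ) (x : A) : h.conv h.convUnit x = x := by
  apply h.toDual_injective
  rw [toDual_conv, toDual_convUnit, one_mul]

theorem conv_convUnit (h : IsHaar ψ) (x : A) : h.conv x h.convUnit = x := by
  apply h.toDual_injective
  rw [toDual_conv, toDual_convUnit, mul_one]

theorem cayley_injective (h : IsHaar ψ) : Function.Injective h.cayley := by
  intro x y hxy
  rw [← h.conv_convUnit x, ← h.conv_convUnit y]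
  exact LinearMap.congr_fun hxy _

theorem cayley_conv (h : IsHaar ψ) (x y : A) :
    h.cayley (h.conv x y) = h.cayley x ∘ₗ h.cayley y :=
  LinearMap.ext fun z => h.conv_assoc x y z

theorem cayley_convUnit (h : IsHaar ψ) : h.cayley h.convUnit = LinearMap.id :=
  LinearMap.ext fun z => h.convUnit_conv z

theorem cayley_one (h : IsHaar ψ) : h.cayley 1 = opJ ψ := by
  have hr : ∑ i ∈ ({()} : Finset Unit), (1 : A) ⊗ₜ[ℂ] (1 : A) = comul (R := ℂ) (1 : A) := by
    simp [Algebra.TensorProduct.one_def]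
  rw [h.cayley_eq_sum (⟨_, _, _, hr⟩ : Coalgebra.Repr ℂ (1 : A) Unit)]
  ext y
  simp [opJ]

theorem schur_cayley (h : IsHaar ψ) (x y : A) :
    h.schur (h.cayley x) (h.cayley y) = h.cayley (x * y) := by
  rw [h.cayley_eq_sum (ℛ ℂ x), h.cayley_eq_sum (ℛ ℂ y),
    h.cayley_eq_sum ((ℛ ℂ x).mul (ℛ ℂ y)), h.schur_sum_sum]
  simp only [h.schur_kernelOp, ← antipode_mul_antidistrib]
  rw [← Finset.sum_product']
  rfl

/-- The adjoint of the kernel `s ⊗ t` is `t^* ⊗ s^*`; for `x₁ ⊗ S(x₂)` this is the kernel of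
`A_{x^⋆}`, as `S² = id` and `S` commutes with `*`. -/
theorem dagger_cayley (h : IsHaar ψ) (x : A) :
    h.dagger (h.cayley x) = h.cayley (costar x) := by
  refine h.toIsFrobenius.eq_dagger fun u y => ?_
  rw [h.cayley_eq_sum (ℛ ℂ x), h.cayley_eq_sum (h.reprCostar (ℛ ℂ x))]
  simp only [LinearMap.sum_apply, kernelOp_tmul, star_sum, star_smul, reprCostar, star_star,
    h.toIsFrobenius.conj_apply, h.antipode_star, h.antipode_antipode, star_mul, Finset.sum_mul,
    Finset.mul_sum, map_sum, smul_mul_assoc, mul_smul_comm, map_smul, smul_eq_mul]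
  exact Finset.sum_congr rfl fun i _ => mul_comm _ _

theorem opStar_cayley (h : IsHaar ψ) (x : A) :
    opStar (h.cayley x) = h.cayley (star x) := by
  ext y
  rw [opStar_apply, h.cayley_eq_sum (ℛ ℂ x),
    h.cayley_eq_sum (⟨_, _, _, comul_sum_star (ℛ ℂ x)⟩ : Coalgebra.Repr ℂ (star x) _)]
  simp only [LinearMap.sum_apply, kernelOp_tmul, star_sum, star_smul, star_star,
    h.toIsFrobenius.conj_apply, h.antipode_star, star_mul]
  exact Finset.sum_congr rfl fun i _ => by rw [h.symmetric]

theorem mem_scheme (h : IsHaar ψ) {S : Submodule ℂ A} {T : A →ₗ[ℂ] A} :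
    T ∈ h.scheme S ↔ ∃ x ∈ S, h.cayley x = T := Submodule.mem_map

theorem IsSchurRing.isTranslationScheme {h : IsHaar ψ} {S : Submodule ℂ A}
    (hS : h.IsSchurRing S) : h.IsTranslationScheme (h.scheme S) where
  comp_mem := by
    simp only [mem_scheme]
    rintro _ _ ⟨x, hx, rfl⟩ ⟨y, hy, rfl⟩
    exact ⟨_, hS.conv_mem hx hy, h.cayley_conv x y⟩
  schur_mem := by
    simp only [mem_scheme]
    rintro _ _ ⟨x, hx, rfl⟩ ⟨y, hy, rfl⟩
    exact ⟨_, hS.mul_mem hx hy, (h.schur_cayley x y).symm⟩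
  dagger_mem := by
    simp only [mem_scheme]
    rintro _ ⟨x, hx, rfl⟩
    exact ⟨_, hS.costar_mem hx, (h.dagger_cayley x).symm⟩
  star_mem := by
    simp only [mem_scheme]
    rintro _ ⟨x, hx, rfl⟩
    exact ⟨_, hS.star_mem hx, (h.opStar_cayley x).symm⟩
  id_mem := h.mem_scheme.2 ⟨_, hS.convUnit_mem, h.cayley_convUnit⟩
  opJ_mem := h.mem_scheme.2 ⟨_, hS.one_mem, h.cayley_one⟩
  le_range := LinearMap.map_le_range

/-- The isomorphism `x ↦ A_x` of a subspace `S` onto the space of operators `{A_x | x ∈ S}`. -/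
noncomputable def schemeEquiv (h : IsHaar ψ) (S : Submodule ℂ A) : S ≃ₗ[ℂ] h.scheme S :=
  Submodule.equivMapOfInjective h.cayley h.cayley_injective S

theorem schemeEquiv_symm (h : IsHaar ψ) {S : Submodule ℂ A} {x : A} (hx : x ∈ S)
    {T : h.scheme S} (hT : h.cayley x = T) : (h.schemeEquiv S).symm T = ⟨x, hx⟩ := by
  rw [LinearEquiv.symm_apply_eq]
  exact Subtype.ext hT.symm

end IsHaar

end TranslationSchemes

/-! ### The Fourier transform exchanges the two products -/

section FourierTransform

open Coalgebra HopfAlgebra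

variable {A : Type u} [Ring A] [StarRing A] [HopfAlgebra ℂ A] [FiniteQuantumGroup A]
  {B : Type v} [Ring B] [StarRing B] [HopfAlgebra ℂ B]
  {ψ : A →ₗ[ℂ] ℂ} {hψ : IsHaar ψ} {F : A ≃ₗ[ℂ] B}

namespace IsHaar.IsFourierTransform

theorem costar_map (hF : hψ.IsFourierTransform F) (x : A) : costar (F x) = F (star x) := by
  rw [costar, hF.star_map, hF.antipode_map, costar, hψ.antipode_antipode]

variable [FiniteQuantumGroup B] {φ : B →ₗ[ℂ] ℂ}

/-- `φ` is the regular trace of `B`, and `F` conjugates `A_x` to left multiplication by `F x`. -/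
theorem haar_map (hF : hψ.IsFourierTransform F) (hφ : IsHaar φ) (x : A) :
    φ (F x) = Module.finrank ℂ A * counit (R := ℂ) x := by
  have h1 : LinearMap.mulLeft ℂ (F x) = F.conj (hψ.cayley x) := by
    ext b
    obtain ⟨y, rfl⟩ := F.surjective b
    rw [LinearEquiv.conj_apply_apply, F.symm_apply_apply]
    exact (hF.map_conv x y).symm
  rw [hφ.toIsQuantumSpace.eq_regularTrace, regularTrace_apply, h1, LinearMap.trace_conj',
    hψ.trace_cayley]

theorem haar_star_mul (hF : hψ.IsFourierTransform F) (hφ : IsHaar φ) (x y : A) :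
    φ (star (F x) * F y) = Module.finrank ℂ A * ψ (star x * y) := by
  rw [hF.star_map, ← hF.map_conv, hF.haar_map hφ, hψ.counit_conv_costar]

theorem conv_map (hF : hψ.IsFourierTransform F) (hφ : IsHaar φ) (x y : A) :
    hφ.conv (F x) (F y) = (Module.finrank ℂ A : ℂ) • F (x * y) := by
  refine hφ.toIsFrobenius.eq_of_forall_left fun w => ?_
  obtain ⟨z, rfl⟩ := (star_involutive.surjective.comp F.surjective) w
  rw [Function.comp_apply]
  -- Each tensor leg contributes a factor `n`. One of the two is absorbed by the inner product on
  -- the other side, leaving the `n` of the statement.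
  have key (t : A ⊗[ℂ] A) :
      tensorSquare φ (star (TensorProduct.map F.toLinearMap F.toLinearMap t) * (F x ⊗ₜ F y)) =
        (Module.finrank ℂ A : ℂ) ^ 2 * tensorSquare ψ (star t * (x ⊗ₜ y)) := by
    induction t using TensorProduct.induction_on with
    | zero => simp
    | add s t hs ht => simp only [map_add, star_add, add_mul, mul_add, hs, ht]
    | tmul s t =>
      simp only [TensorProduct.map_tmul, LinearEquiv.coe_coe, TensorProduct.star_tmul,
        Algebra.TensorProduct.tmul_mul_tmul, tensorSquare_tmul, hF.haar_star_mul hφ]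
      ring
  rw [hφ.apply_mul_conv, FiniteQuantumGroup.comul_star, hF.comul_map, key, mul_smul_comm, map_smul,
    hF.haar_star_mul hφ, smul_eq_mul, ← mul_assoc, ← sq]
  congr 1
  exact hψ.toIsFrobenius.daggerOfTensor_spec (LinearMap.mul' ℂ A) z (x ⊗ₜ y)

theorem convUnit_eq (hF : hψ.IsFourierTransform F) (hφ : IsHaar φ) :
    hφ.convUnit = (Module.finrank ℂ A : ℂ)⁻¹ • F 1 := by
  refine hφ.toIsFrobenius.eq_of_forall_left fun w => ?_
  obtain ⟨z, rfl⟩ := (star_involutive.surjective.comp F.surjective) w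
  rw [Function.comp_apply]
  rw [hφ.apply_mul_convUnit, FiniteQuantumGroup.counit_star, hF.counit_map, mul_smul_comm, map_smul,
    hF.haar_star_mul hφ, mul_one, smul_eq_mul,
    inv_mul_cancel_left₀ (finrank_ne_zero_of_hopfAlgebra A), hψ.toIsFrobenius.conj_apply]

theorem isSchurRing_map (hF : hψ.IsFourierTransform F) (hφ : IsHaar φ) {S : Submodule ℂ A}
    (hS : hψ.IsSchurRing S) : hφ.IsSchurRing (S.map F.toLinearMap) where
  mul_mem := by
    rintro _ _ ⟨x, hx, rfl⟩ ⟨y, hy, rfl⟩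
    exact ⟨_, hS.conv_mem hx hy, hF.map_conv x y⟩
  conv_mem := by
    rintro _ _ ⟨x, hx, rfl⟩ ⟨y, hy, rfl⟩
    have := hF.conv_map hφ x y
    rw [LinearEquiv.coe_coe, this]
    exact Submodule.smul_mem _ _ ⟨_, hS.mul_mem hx hy, rfl⟩
  star_mem := by
    rintro _ ⟨x, hx, rfl⟩
    exact ⟨_, hS.costar_mem hx, (hF.star_map x).symm⟩
  costar_mem := by
    rintro _ ⟨x, hx, rfl⟩
    exact ⟨_, hS.star_mem hx, (hF.costar_map x).symm⟩
  one_mem := ⟨_, hS.convUnit_mem, hF.map_convUnit⟩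
  convUnit_mem := by
    rw [hF.convUnit_eq hφ]
    exact Submodule.smul_mem _ _ ⟨_, hS.one_mem, rfl⟩

variable (hψ F) in
/-- The map `A_x ↦ n⁻¹ A_{F x}` from `{A_x | x ∈ S}` to `{A_{F x} | x ∈ S}`. -/
noncomputable def dualityEquiv (hφ : IsHaar φ) (S : Submodule ℂ A) :
    hψ.scheme S ≃ₗ[ℂ] hφ.scheme (S.map F.toLinearMap) :=
  (hψ.schemeEquiv S).symm ≪≫ₗ F.submoduleMap S ≪≫ₗ hφ.schemeEquiv (S.map F.toLinearMap) ≪≫ₗ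
    LinearEquiv.smulOfNeZero ℂ (hφ.scheme (S.map F.toLinearMap)) (Module.finrank ℂ A : ℂ)⁻¹
      (inv_ne_zero (finrank_ne_zero_of_hopfAlgebra A))

theorem dualityEquiv_apply (hφ : IsHaar φ) {S : Submodule ℂ A} {x : A} (hx : x ∈ S)
    {T : hψ.scheme S} (hT : hψ.cayley x = T) :
    (dualityEquiv hψ F hφ S T : B →ₗ[ℂ] B) =
      (Module.finrank ℂ A : ℂ)⁻¹ • hφ.cayley (F x) := by
  simp only [dualityEquiv, LinearEquiv.trans_apply, hψ.schemeEquiv_symm hx hT]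
  rfl

/-- For composition, `n⁻¹ = n · n⁻¹ · n⁻¹`; for the Schur product, the two factors `n⁻¹` meet the
`n` of `conv_map`. Since `n⁻¹` is real, it passes through both involutions. -/
theorem isDuality (hF : hψ.IsFourierTransform F) (hφ : IsHaar φ) {S : Submodule ℂ A}
    (hA : IsCoherent hψ.toIsQuantumSpace (hψ.scheme S))
    (hB : IsCoherent hφ.toIsQuantumSpace (hφ.scheme (S.map F.toLinearMap)))
    (hS : hψ.IsSchurRing S) : IsDuality hA hB (dualityEquiv hψ F hφ S) where
  finrank_eq := F.finrank_eq
  map_comp := by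
    rintro ⟨_, x, hx, rfl⟩ ⟨_, y, hy, rfl⟩
    rw [dualityEquiv_apply hφ (hS.conv_mem hx hy) (hψ.cayley_conv x y),
      dualityEquiv_apply hφ hx rfl, dualityEquiv_apply hφ hy rfl, hφ.schur_smul_smul,
      hφ.schur_cayley, hF.map_conv, smul_smul,
      mul_inv_cancel_left₀ (finrank_ne_zero_of_hopfAlgebra A)]
  map_schur := by
    rintro ⟨_, x, hx, rfl⟩ ⟨_, y, hy, rfl⟩
    rw [dualityEquiv_apply hφ (hS.mul_mem hx hy) (hψ.schur_cayley x y).symm,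
      dualityEquiv_apply hφ hx rfl, dualityEquiv_apply hφ hy rfl, LinearMap.smul_comp,
      LinearMap.comp_smul, ← hφ.cayley_conv, hF.conv_map hφ, map_smul, smul_smul (_⁻¹) _ (hφ.cayley _),
      inv_mul_cancel₀ (finrank_ne_zero_of_hopfAlgebra A), one_smul]
  map_dagger := by
    rintro ⟨_, x, hx, rfl⟩
    rw [dualityEquiv_apply hφ (hS.costar_mem hx) (hψ.dagger_cayley x).symm,
      dualityEquiv_apply hφ hx rfl, ← hF.star_map,
      ← hφ.opStar_cayley]
    ext b
    simp [opStar_apply]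
  map_star := by
    rintro ⟨_, x, hx, rfl⟩
    rw [dualityEquiv_apply hφ (hS.star_mem hx) (hψ.opStar_cayley x).symm,
      dualityEquiv_apply hφ hx rfl, ← hF.costar_map,
      ← hφ.dagger_cayley]
    symm
    refine hφ.toIsFrobenius.eq_dagger fun a b => ?_
    simp [hφ.toIsFrobenius.dagger_spec]

end IsHaar.IsFourierTransform

end FourierTransform

/-! ### C*-structure from a faithful representation on a Hilbert space -/

section RegularRepresentation

theorem exists_cstarAlgebra_of_injective {A H : Type u} [Ring A] [StarRing A] [Algebra ℂ A]
    [StarModule ℂ A] [FiniteDimensional ℂ A] [NormedAddCommGroup H] [InnerProductSpace ℂ H]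
    [CompleteSpace H] (π : A →⋆ₐ[ℂ] (H →L[ℂ] H)) (hπ : Function.Injective π) :
    ∃ (C : Type u) (_ : CStarAlgebra C), Nonempty (A ≃⋆ₐ[ℂ] C) := by
  let : CStarAlgebra (H →L[ℂ] H) := {}
  have hfin : FiniteDimensional ℂ π.range :=
    LinearMap.finiteDimensional_range (π.toAlgHom.toLinearMap)
  have : IsClosed (π.range : Set (H →L[ℂ] H)) :=
    Submodule.closed_of_finiteDimensional π.range.toSubalgebra.toSubmodule
  exact ⟨π.range, StarSubalgebra.cstarAlgebra π.range, ⟨StarAlgEquiv.ofInjective π hπ⟩⟩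

/-- Left multiplication on `l²` is a `*`-representation, faithful by evaluation at `1`; its
finite-dimensional image is closed. -/
theorem IsFrobenius.exists_cstarAlgebra {A : Type u} [Ring A] [StarRing A] [Algebra ℂ A]
    [StarModule ℂ A] [FiniteDimensional ℂ A] {ψ : A →ₗ[ℂ] ℂ} (h : IsFrobenius ψ) :
    ∃ (C : Type u) (_ : CStarAlgebra C), Nonempty (A ≃⋆ₐ[ℂ] C) := by
  let := h.normedAddCommGroup
  let := h.innerProductSpace
  have hinner (x y : A) : inner ℂ x y = ψ (star x * y) := rfl
  have : CompleteSpace A := FiniteDimensional.complete ℂ A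
  let π : A →⋆ₐ[ℂ] (A →L[ℂ] A) :=
    { toFun a := LinearMap.toContinuousLinearMap (LinearMap.mulLeft ℂ a)
      map_one' := by ext; simp
      map_mul' _ _ := by ext; simp
      map_zero' := by ext; simp
      map_add' _ _ := by ext; simp [add_mul]
      commutes' c := by ext; simp [Algebra.smul_def]
      map_star' a := by
        rw [ContinuousLinearMap.star_eq_adjoint, ContinuousLinearMap.eq_adjoint_iff]
        intro x y
        simp [hinner, mul_assoc] }
  refine exists_cstarAlgebra_of_injective π fun a b hab => ?_
  have := congrArg (fun T : A →L[ℂ] A => T 1) hab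
  simpa [π] using this

end RegularRepresentation

/-! ### The dual bialgebra -/

section Dual

open Coalgebra HopfAlgebra

variable {A : Type u} [Ring A] [HopfAlgebra ℂ A]

variable (A) in
/-- The algebra of functions on the dual of a finite quantum group: the dual of `A`, with the
convolution product. -/
def QuantumDual : Type u := WithConv (A →ₗ[ℂ] ℂ)

namespace QuantumDual

noncomputable instance : Ring (QuantumDual A) := inferInstanceAs (Ring (WithConv (A →ₗ[ℂ] ℂ)))

noncomputable instance : Algebra ℂ (QuantumDual A) :=
  inferInstanceAs (Algebra ℂ (WithConv (A →ₗ[ℂ] ℂ)))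

variable (A) in
/-- The pairing of the dual with `A`. -/
noncomputable def pairing : QuantumDual A ≃ₗ[ℂ] Module.Dual ℂ A :=
  WithConv.linearEquiv ℂ (A →ₗ[ℂ] ℂ)

instance [FiniteDimensional ℂ A] : FiniteDimensional ℂ (QuantumDual A) :=
  (pairing A).symm.finiteDimensional

theorem ext_pairing {f g : QuantumDual A} (h : ∀ a, pairing A f a = pairing A g a) : f = g :=
  (pairing A).injective (LinearMap.ext h)

theorem pairing_mul {ι : Type*} {a : A} (r : Coalgebra.Repr ℂ a ι) (f g : QuantumDual A) :
    pairing A (f * g) a = ∑ i ∈ r.index, pairing A f (r.left i) * pairing A g (r.right i) :=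
  r.convMul_apply f g

theorem pairing_one (a : A) : pairing A 1 a = counit (R := ℂ) a := rfl

theorem pairing_algebraMap (c : ℂ) (a : A) :
    pairing A (algebraMap ℂ _ c) a = c * counit (R := ℂ) a := by
  rw [Algebra.algebraMap_eq_smul_one, map_smul]
  rfl

variable [FiniteDimensional ℂ A]

variable (A) in
/-- The pairing of the tensor square of the dual with `A ⊗ A`. -/
noncomputable def pairing₂ :
    QuantumDual A ⊗[ℂ] QuantumDual A ≃ₗ[ℂ] Module.Dual ℂ (A ⊗[ℂ] A) :=
  TensorProduct.congr (pairing A) (pairing A) ≪≫ₗ TensorProduct.dualDistribEquiv ℂ A A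

@[simp]
theorem pairing₂_tmul (f g : QuantumDual A) (a b : A) :
    pairing₂ A (f ⊗ₜ g) (a ⊗ₜ b) = pairing A f a * pairing A g b := rfl

variable (A) in
/-- The pairing of the tensor cube of the dual with `A ⊗ (A ⊗ A)`. -/
noncomputable def pairing₃ :
    QuantumDual A ⊗[ℂ] (QuantumDual A ⊗[ℂ] QuantumDual A) ≃ₗ[ℂ]
      Module.Dual ℂ (A ⊗[ℂ] (A ⊗[ℂ] A)) :=
  TensorProduct.congr (pairing A) (pairing₂ A) ≪≫ₗ TensorProduct.dualDistribEquiv ℂ A (A ⊗[ℂ] A)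

@[simp]
theorem pairing₃_tmul (f : QuantumDual A) (t : QuantumDual A ⊗[ℂ] QuantumDual A) (a : A)
    (s : A ⊗[ℂ] A) : pairing₃ A (f ⊗ₜ t) (a ⊗ₜ s) = pairing A f a * pairing₂ A t s := rfl

theorem ext_pairing₂ {s t : QuantumDual A ⊗[ℂ] QuantumDual A}
    (h : ∀ a b, pairing₂ A s (a ⊗ₜ b) = pairing₂ A t (a ⊗ₜ b)) : s = t :=
  (pairing₂ A).injective (TensorProduct.ext' h)

/-- The coproduct is dual to the opposite multiplication: `m† x` paired with `a ⊗ b` through `ψ ⊗ ψ`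
is `ψ (b a x)`. -/
noncomputable instance : CoalgebraStruct ℂ (QuantumDual A) where
  comul := (pairing₂ A).symm.toLinearMap ∘ₗ
    (LinearMap.mul' ℂ A ∘ₗ (TensorProduct.comm ℂ A A).toLinearMap).dualMap ∘ₗ
      (pairing A).toLinearMap
  counit := LinearMap.applyₗ 1 ∘ₗ (pairing A).toLinearMap

@[simp]
theorem pairing₂_comul (f : QuantumDual A) (a b : A) :
    pairing₂ A (comul f) (a ⊗ₜ b) = pairing A f (b * a) :=
  LinearMap.congr_fun ((pairing₂ A).apply_symm_apply _) (a ⊗ₜ b)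

theorem counit_eq (f : QuantumDual A) : counit (R := ℂ) f = pairing A f 1 := rfl

noncomputable instance : Coalgebra ℂ (QuantumDual A) where
  coassoc := by
    have h1 (t : QuantumDual A ⊗[ℂ] QuantumDual A) (a b c : A) :
        pairing₃ A (comul.lTensor _ t) (a ⊗ₜ (b ⊗ₜ c)) = pairing₂ A t (a ⊗ₜ (c * b)) := by
      induction t using TensorProduct.induction_on with
      | zero => simp
      | add s t hs ht => simp only [map_add, LinearMap.add_apply, hs, ht]
      | tmul f g => simp
    have h2 (t : QuantumDual A ⊗[ℂ] QuantumDual A) (g : QuantumDual A) (a b c : A) :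
        pairing₃ A (TensorProduct.assoc ℂ _ _ _ (t ⊗ₜ g)) (a ⊗ₜ (b ⊗ₜ c)) =
          pairing₂ A t (a ⊗ₜ b) * pairing A g c := by
      induction t using TensorProduct.induction_on with
      | zero => simp
      | add s t hs ht =>
        simp only [map_add, TensorProduct.add_tmul, LinearMap.add_apply, hs, ht, add_mul]
      | tmul f g => simp [mul_assoc]
    have h3 (t : QuantumDual A ⊗[ℂ] QuantumDual A) (a b c : A) :
        pairing₃ A (TensorProduct.assoc ℂ _ _ _ (comul.rTensor _ t)) (a ⊗ₜ (b ⊗ₜ c)) =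
          pairing₂ A t ((b * a) ⊗ₜ c) := by
      induction t using TensorProduct.induction_on with
      | zero => simp
      | add s t hs ht => simp only [map_add, LinearMap.add_apply, hs, ht]
      | tmul f g => rw [LinearMap.rTensor_tmul, h2]; simp
    ext f
    apply (pairing₃ A).injective
    ext a b c
    have e1 := h1 (comul f) a b c
    have e3 := h3 (comul f) a b c
    rw [pairing₂_comul] at e1 e3
    exact e3.trans ((congrArg (pairing A f) (mul_assoc _ _ _).symm).trans e1.symm)
  rTensor_counit_comp_comul := by
    have h1 (t : QuantumDual A ⊗[ℂ] QuantumDual A) (a : A) :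
        pairing A (TensorProduct.lid ℂ _ (counit.rTensor _ t)) a = pairing₂ A t (1 ⊗ₜ a) := by
      induction t using TensorProduct.induction_on with
      | zero => simp
      | add s t hs ht => simp only [map_add, LinearMap.add_apply, hs, ht]
      | tmul f g => simp [counit_eq]
    ext f
    apply (TensorProduct.lid ℂ _).injective
    refine ext_pairing fun a => (h1 _ a).trans ?_
    simp
  lTensor_counit_comp_comul := by
    have h1 (t : QuantumDual A ⊗[ℂ] QuantumDual A) (a : A) :
        pairing A (TensorProduct.rid ℂ _ (counit.lTensor _ t)) a = pairing₂ A t (a ⊗ₜ 1) := by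
      induction t using TensorProduct.induction_on with
      | zero => simp
      | add s t hs ht => simp only [map_add, LinearMap.add_apply, hs, ht]
      | tmul f g => simp [counit_eq, mul_comm]
    ext f
    apply (TensorProduct.rid ℂ _).injective
    refine ext_pairing fun a => (h1 _ a).trans ?_
    simp

theorem pairing₂_mul {ι κ : Type*} {a b : A} (r : Coalgebra.Repr ℂ a ι) (r' : Coalgebra.Repr ℂ b κ)
    (s t : QuantumDual A ⊗[ℂ] QuantumDual A) :
    pairing₂ A (s * t) (a ⊗ₜ b) = ∑ i ∈ r.index, ∑ j ∈ r'.index,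
      pairing₂ A s (r.left i ⊗ₜ r'.left j) * pairing₂ A t (r.right i ⊗ₜ r'.right j) := by
  induction s using TensorProduct.induction_on with
  | zero => simp
  | add s s' hs hs' => simp only [add_mul, map_add, LinearMap.add_apply, hs, hs',
      Finset.sum_add_distrib]
  | tmul f g =>
    induction t using TensorProduct.induction_on with
    | zero => simp
    | add t t' ht ht' => simp only [mul_add, map_add, LinearMap.add_apply, ht, ht',
        Finset.sum_add_distrib]
    | tmul f' g' =>
      rw [Algebra.TensorProduct.tmul_mul_tmul, pairing₂_tmul, pairing_mul r, pairing_mul r',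
        Finset.sum_mul_sum]
      simp only [pairing₂_tmul, mul_mul_mul_comm]

noncomputable instance : Bialgebra ℂ (QuantumDual A) :=
  Bialgebra.mk' ℂ (QuantumDual A)
    (by rw [counit_eq, pairing_one]; simp)
    (by
      intro f g
      have hr : ∑ i ∈ ({()} : Finset Unit), (1 : A) ⊗ₜ[ℂ] (1 : A) = comul (R := ℂ) (1 : A) := by
        simp [Algebra.TensorProduct.one_def]
      rw [counit_eq, pairing_mul (⟨_, _, _, hr⟩ : Coalgebra.Repr ℂ (1 : A) Unit)]
      simp [counit_eq])
    (by
      refine ext_pairing₂ fun a b => ?_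
      rw [pairing₂_comul, Algebra.TensorProduct.one_def, pairing₂_tmul]
      simp [pairing_one, mul_comm])
    (by
      intro f g
      refine ext_pairing₂ fun a b => ?_
      rw [pairing₂_comul, pairing₂_mul (ℛ ℂ a) (ℛ ℂ b), pairing_mul ((ℛ ℂ b).mul (ℛ ℂ a))]
      simp only [pairing₂_comul]
      rw [Finset.sum_comm, ← Finset.sum_product']
      rfl)

end QuantumDual

end Dual

/-! ### The dual finite quantum group and its Fourier transform -/

section DualQuantumGroup

open Coalgebra HopfAlgebra

variable {A : Type u} [Ring A] [StarRing A] [HopfAlgebra ℂ A]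

theorem costar_mul (a b : A) : costar (a * b) = costar a * costar b := by
  rw [costar, star_mul, antipode_mul_antidistrib, costar, costar]

variable [FiniteQuantumGroup A]

namespace FiniteQuantumGroup

theorem antipode_antipode (a : A) : antipode ℂ (antipode ℂ a) = a :=
  (FiniteQuantumGroup.isHaar_regularTrace A).antipode_antipode a

theorem antipode_star (a : A) : antipode ℂ (star a) = star (antipode ℂ a) :=
  (FiniteQuantumGroup.isHaar_regularTrace A).antipode_star a

/-- The opposite coproduct on the dual requires the antipode axioms with legs exchanged; these
follow by applying `S`, because `S² = id`. -/
theorem sum_right_mul_antipode_left {ι : Type*} {a : A} (r : Coalgebra.Repr ℂ a ι) :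
    ∑ i ∈ r.index, r.right i * antipode ℂ (r.left i) = counit (R := ℂ) a • (1 : A) := by
  have := congrArg (antipode ℂ) (sum_mul_antipode_eq_smul r)
  simpa [antipode_mul_antidistrib, antipode_antipode] using this

theorem sum_antipode_right_mul_left {ι : Type*} {a : A} (r : Coalgebra.Repr ℂ a ι) :
    ∑ i ∈ r.index, antipode ℂ (r.right i) * r.left i = counit (R := ℂ) a • (1 : A) := by
  have := congrArg (antipode ℂ) (sum_antipode_mul_eq_smul r)
  simpa [antipode_mul_antidistrib, antipode_antipode] using this

end FiniteQuantumGroup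

/-- The functional `ψ ⊗ ψ S` is unchanged by the flip followed by `S ⊗ S`. Evaluating it on `Δ(a)`
and on `Δ(S a)` gives `n ψ(a) = n ψ(S a)`. -/
theorem IsHaar.apply_antipode {ψ : A →ₗ[ℂ] ℂ} (h : IsHaar ψ) (a : A) : ψ (antipode ℂ a) = ψ a := by
  have h1 (a : A) : leftSlice ψ (comul a) = ψ a • (1 : A) := h.left_invariant a
  have h2 (t : A ⊗[ℂ] A) : ψ (antipode ℂ (leftSlice ψ t)) =
      ψ (antipode ℂ (leftSlice ψ (TensorProduct.map (antipode ℂ) (antipode ℂ)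
        (TensorProduct.comm ℂ A A t)))) := by
    induction t using TensorProduct.induction_on with
    | zero => simp
    | add s t hs ht => simp only [map_add, hs, ht]
    | tmul s t => simp [h.antipode_antipode, mul_comm]
  have h3 := h2 (comul a)
  rw [← comul_antipode, h1, h1] at h3
  simp only [map_smul, antipode_one, h.apply_one, smul_eq_mul] at h3
  exact (mul_right_cancel₀ (finrank_ne_zero_of_hopfAlgebra A) h3).symm

namespace QuantumDual

noncomputable instance : HopfAlgebra ℂ (QuantumDual A) where
  antipode := (pairing A).symm.toLinearMap ∘ₗ (antipode ℂ (A := A)).dualMap ∘ₗ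
    (pairing A).toLinearMap
  mul_antipode_rTensor_comul := by
    ext f
    refine ext_pairing fun a => ?_
    have key (t : QuantumDual A ⊗[ℂ] QuantumDual A) :
        pairing A (LinearMap.mul' ℂ _ (LinearMap.rTensor _ ((pairing A).symm.toLinearMap ∘ₗ
          (antipode ℂ (A := A)).dualMap ∘ₗ (pairing A).toLinearMap) t)) a =
        ∑ i ∈ (ℛ ℂ a).index,
          pairing₂ A t (antipode ℂ ((ℛ ℂ a).left i) ⊗ₜ (ℛ ℂ a).right i) := by
      induction t using TensorProduct.induction_on with
      | zero => simp
      | add s t hs ht => simp only [map_add, LinearMap.add_apply, hs, ht, Finset.sum_add_distrib]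
      | tmul f g => simp [pairing_mul (ℛ ℂ a)]
    refine (key _).trans ?_
    simp only [pairing₂_comul, ← map_sum, FiniteQuantumGroup.sum_right_mul_antipode_left]
    simp [pairing_algebraMap, counit_eq, mul_comm]
  mul_antipode_lTensor_comul := by
    ext f
    refine ext_pairing fun a => ?_
    have key (t : QuantumDual A ⊗[ℂ] QuantumDual A) :
        pairing A (LinearMap.mul' ℂ _ (LinearMap.lTensor _ ((pairing A).symm.toLinearMap ∘ₗ
          (antipode ℂ (A := A)).dualMap ∘ₗ (pairing A).toLinearMap) t)) a =
        ∑ i ∈ (ℛ ℂ a).index,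
          pairing₂ A t ((ℛ ℂ a).left i ⊗ₜ antipode ℂ ((ℛ ℂ a).right i)) := by
      induction t using TensorProduct.induction_on with
      | zero => simp
      | add s t hs ht => simp only [map_add, LinearMap.add_apply, hs, ht, Finset.sum_add_distrib]
      | tmul f g => simp [pairing_mul (ℛ ℂ a)]
    refine (key _).trans ?_
    simp only [pairing₂_comul, ← map_sum, FiniteQuantumGroup.sum_antipode_right_mul_left]
    simp [pairing_algebraMap, counit_eq, mul_comm]

theorem pairing_antipode (f : QuantumDual A) (a : A) :
    pairing A (antipode ℂ f) a = pairing A f (antipode ℂ a) := rfl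

noncomputable instance : Star (QuantumDual A) where
  star f := (pairing A).symm
    { toFun a := star (pairing A f (costar a))
      map_add' := by simp [costar]
      map_smul' := by simp [costar] }

theorem pairing_star (f : QuantumDual A) (a : A) :
    pairing A (star f) a = star (pairing A f (costar a)) := rfl

noncomputable instance : StarRing (QuantumDual A) where
  star_involutive f := ext_pairing fun a => by
    rw [pairing_star, pairing_star, star_star, (FiniteQuantumGroup.isHaar_regularTrace A).costar_costar]
  star_mul f g := ext_pairing fun a => by
    rw [pairing_star, pairing_mul ((FiniteQuantumGroup.isHaar_regularTrace A).reprCostar (ℛ ℂ a)),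
      pairing_mul (ℛ ℂ a), star_sum]
    refine Finset.sum_congr rfl fun i _ => ?_
    rw [pairing_star, pairing_star, star_mul]
    simp only [IsHaar.reprCostar, costar, FiniteQuantumGroup.antipode_star]
  star_add f g := ext_pairing fun a => by
    simp [pairing_star]

instance : StarModule ℂ (QuantumDual A) where
  star_smul c f := ext_pairing fun a => by
    simp [pairing_star]

/-- The Fourier transform `x ↦ ψ(· x)` onto the dual of `A`. -/
noncomputable def fourier {ψ : A →ₗ[ℂ] ℂ} (h : IsHaar ψ) : A ≃ₗ[ℂ] QuantumDual A :=
  LinearMap.linearEquivOfInjective (V₂ := QuantumDual A) h.toDual h.toDual_injective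
    (by rw [(pairing A).finrank_eq, Subspace.dual_finrank_eq])

variable {ψ : A →ₗ[ℂ] ℂ}

theorem pairing_fourier (h : IsHaar ψ) (x a : A) : pairing A (fourier h x) a = ψ (a * x) := rfl

theorem fourier_conv (h : IsHaar ψ) (x y : A) :
    fourier h (h.conv x y) = fourier h x * fourier h y := h.toDual_conv x y

theorem fourier_convUnit (h : IsHaar ψ) : fourier h h.convUnit = 1 := h.toDual_convUnit

theorem comul_fourier (h : IsHaar ψ) (x : A) : comul (R := ℂ) (fourier h x) =
    TensorProduct.map (fourier h).toLinearMap (fourier h).toLinearMap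
      (h.daggerOfTensor (LinearMap.mul' ℂ A) x) := by
  have key (a b : A) (t : A ⊗[ℂ] A) : pairing₂ A (TensorProduct.map (fourier h).toLinearMap
      (fourier h).toLinearMap t) (a ⊗ₜ b) = tensorSquare ψ ((a ⊗ₜ b) * t) := by
    induction t using TensorProduct.induction_on with
    | zero => simp
    | add s t hs ht => simp only [map_add, LinearMap.add_apply, hs, ht, mul_add]
    | tmul s t => simp [pairing_fourier]
  refine ext_pairing₂ fun a b => ?_
  rw [key, h.toIsFrobenius.tensorSquare_tmul_mul_dagger_mul, pairing₂_comul, pairing_fourier]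

theorem counit_fourier (h : IsHaar ψ) (x : A) : counit (R := ℂ) (fourier h x) = ψ x := by
  rw [counit_eq, pairing_fourier, one_mul]

theorem antipode_fourier (h : IsHaar ψ) (x : A) :
    antipode ℂ (fourier h x) = fourier h (antipode ℂ x) := by
  refine ext_pairing fun a => ?_
  rw [pairing_antipode, pairing_fourier, pairing_fourier, ← h.apply_antipode,
    antipode_mul_antidistrib, h.antipode_antipode, h.symmetric]

theorem star_fourier (h : IsHaar ψ) (x : A) : star (fourier h x) = fourier h (costar x) := by
  refine ext_pairing fun a => ?_
  rw [pairing_star, pairing_fourier, pairing_fourier, h.toIsFrobenius.conj_apply, star_mul, costar,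
    costar, ← h.apply_antipode (a * _), antipode_mul_antidistrib, h.antipode_antipode,
    h.antipode_star, star_star]

/-- By `counit_conv_costar`, this functional gives the dual the inner product of `l²(Γ)`, which
supplies the Hilbert space for its C*-structure. -/
theorem isFrobenius (h : IsHaar ψ) :
    IsFrobenius ((counit (R := ℂ) (A := A)) ∘ₗ (fourier h).symm.toLinearMap) := by
  have key (x : A) : (counit (R := ℂ) (A := A) ∘ₗ (fourier h).symm.toLinearMap)
      (star (fourier h x) * fourier h x) = ψ (star x * x) := by
    rw [star_fourier, ← fourier_conv, LinearMap.comp_apply, LinearEquiv.coe_coe,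
      LinearEquiv.symm_apply_apply, h.counit_conv_costar]
  refine .of_definite (fun f => ?_) fun f hf => ?_
  · obtain ⟨x, rfl⟩ := (fourier h).surjective f
    rw [key]
    exact h.positive x
  · obtain ⟨x, rfl⟩ := (fourier h).surjective f
    rw [key] at hf
    rw [h.toIsFrobenius.eq_zero_of_star_mul_self hf, map_zero]

instance : FiniteQuantumGroup (QuantumDual A) where
  comul_star f := by
    have key (t : QuantumDual A ⊗[ℂ] QuantumDual A) (a b : A) :
        pairing₂ A (star t) (a ⊗ₜ b) = star (pairing₂ A t (costar a ⊗ₜ costar b)) := by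
      induction t using TensorProduct.induction_on with
      | zero => simp
      | add s t hs ht => simp only [map_add, star_add, LinearMap.add_apply, hs, ht]
      | tmul f g =>
        rw [TensorProduct.star_tmul, pairing₂_tmul, pairing₂_tmul, pairing_star, pairing_star,
          star_mul']
    refine ext_pairing₂ fun a b => ?_
    rw [key, pairing₂_comul, pairing₂_comul, pairing_star, costar_mul]
  counit_star f := by
    rw [counit_eq, counit_eq, pairing_star, costar, star_one, antipode_one]
  exists_cstarAlgebra := (isFrobenius (FiniteQuantumGroup.isHaar_regularTrace A)).exists_cstarAlgebra

theorem isFourierTransform_fourier (h : IsHaar ψ) : h.IsFourierTransform (fourier h) where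
  map_conv := fourier_conv h
  map_convUnit := fourier_convUnit h
  comul_map := comul_fourier h
  counit_map := counit_fourier h
  antipode_map := antipode_fourier h
  star_map := star_fourier h

end QuantumDual

end DualQuantumGroup

theorem mainTheorem1 {A : Type u} [Ring A] [StarRing A] [HopfAlgebra ℂ A] [FiniteQuantumGroup A] :
    -- the normalized Haar functional and the dual quantum group exist
    (∃! ψ : A →ₗ[ℂ] ℂ, IsHaar ψ) ∧
    ∀ (ψ : A →ₗ[ℂ] ℂ) (hψ : IsHaar ψ),
      (∃ (B : Type u) (_ : Ring B) (_ : StarRing B) (_ : HopfAlgebra ℂ B)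
        (_ : FiniteQuantumGroup B) (F : A ≃ₗ[ℂ] B), hψ.IsFourierTransform F) ∧
      -- the duality, for `B = C(Γ̂)` and every quantum Schur ring `S`
      ∀ (B : Type v) [Ring B] [StarRing B] [HopfAlgebra ℂ B] [FiniteQuantumGroup B]
        (F : A ≃ₗ[ℂ] B), hψ.IsFourierTransform F →
        (∃! φ : B →ₗ[ℂ] ℂ, IsHaar φ) ∧
        ∀ (φ : B →ₗ[ℂ] ℂ) (hφ : IsHaar φ) (S : Submodule ℂ A), hψ.IsSchurRing S →
          hφ.IsSchurRing (S.map F.toLinearMap) ∧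
          ∃ (hA : hψ.IsTranslationScheme (hψ.scheme S))
            (hB : hφ.IsTranslationScheme (hφ.scheme (S.map F.toLinearMap)))
            (Φ : hψ.scheme S ≃ₗ[ℂ] hφ.scheme (S.map F.toLinearMap)),
            IsDuality hA.toIsCoherent hB.toIsCoherent Φ ∧
            ∀ (x : A) (hx : x ∈ S),
              (Φ ⟨hψ.cayley x, Submodule.mem_map_of_mem hx⟩ : B →ₗ[ℂ] B) =
                (Module.finrank ℂ A : ℂ)⁻¹ • hφ.cayley (F x) := by
  refine ⟨FiniteQuantumGroup.existsUnique_isHaar A, fun ψ hψ =>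
    ⟨⟨QuantumDual A, inferInstance, inferInstance, inferInstance, inferInstance,
      QuantumDual.fourier hψ, QuantumDual.isFourierTransform_fourier hψ⟩, ?_⟩⟩
  intro B _ _ _ _ F hF
  refine ⟨FiniteQuantumGroup.existsUnique_isHaar B, fun φ hφ S hS => ?_⟩
  have hS' := hF.isSchurRing_map hφ hS
  exact ⟨hS', hS.isTranslationScheme, hS'.isTranslationScheme,
    IsHaar.IsFourierTransform.dualityEquiv hψ F hφ S, hF.isDuality hφ _ _ hS,
    fun x hx => IsHaar.IsFourierTransform.dualityEquiv_apply hφ hx rfl⟩
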